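/- For $p\in(1,2]$ let $\frac1p+\frac1{p'}=1$. Consider the following online convex optimization protocol on $\mathbb{R}^d$ with known horizon $n$. In each round $t=1,\dots,n$ a learner with access to fair coin tosses plays $w_t\in\mathbb{R}^d$; nature's convex loss $f_t:\mathbb{R}^d\to\mathbb{R}$ may depend on the algorithm and on all plays and coin tosses of the rounds before $t$, but not on the coin tosses of round $t$. After playing, the learner may query $f_t$ for its value and a subgradient at points of its choice. A convex $f$ is called $K$-Lipschitz w.r.t. $\|\cdot\|_{p'}$ if $\|g\|_{p'}\le K$ for all its subgradients $g$ (equivalently, $|f(x)-f(y)|\le K\|x-y\|_p$ for all $x,y$). There are a single algorithm, an absolute constant $C$ and a polynomial $P$ such that the following holds for all $n,d\in\mathbb{N}$, $0<\delta\le 1$ and all constants $L_p\ge 1$, $p\in[1+\delta,2]$. The algorithm is given $n$, $d$, $\delta$ and access to the Lipschitz constants, through the function $p\mapsto\inf_{q\in[p,2]}L_q$ (which is $L_p$ when $L$ is nondecreasing in $p$, as the best Lipschitz constants are). Suppose that, for every $p\in[1+\delta,2]$, all losses $f_t$ are $L_p$-Lipschitz w.r.t. $\|\cdot\|_{p'}$.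 Then the algorithm makes at most $P(n,d)$ steps before the first round and at most $P(n,d)$ steps in each round, and $$\mathbb{E}\Big[\sum_{t=1}^{n}f_t(w_t)-\sum_{t=1}^{n}f_t(w)\Big]\le C\,(\|w\|_p+1)\,L_p\sqrt{\frac{n\log\big((\|w\|_p+1)\,L_p\,\max\{1,\log d\}\,n\big)}{p-1}}$$ simultaneously for all $w\in\mathbb{R}^d$ and all $p\in[1+\delta,2]$. Steps are counted on a real-number machine with bounded loops: arithmetic and comparison of reals, $\exp$, $\log$, powers of absolute values, integer index arithmetic, a coin toss, and looking up one Lipschitz constant cost one step each, and a query to the loss costs $d+1$ steps. -/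

import Mathlib

noncomputable section

namespace OnlineLp

/-! ### Vectors, norms, losses -/

/-- Decision vectors, i.e. points of `ℝ^d`. -/
abbrev Vec (d : ℕ) : Type := Fin d → ℝ

/-- The `ℓ_p` norm on `ℝ^d`. -/
def lpNorm {d : ℕ} (p : ℝ) (x : Vec d) : ℝ :=
  ‖(WithLp.toLp (ENNReal.ofReal p) x : PiLp (ENNReal.ofReal p) (fun _ : Fin d => ℝ))‖

/-- `g` is a subgradient of `f` at `x`. -/
def IsSubgradient {d : ℕ} (f : Vec d → ℝ) (x g : Vec d) : Prop :=
  ∀ y : Vec d, f x + ∑ i, g i * (y i - x i) ≤ f y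

/-- The convex function `f` on `ℝ^d` is `K`-Lipschitz with respect to the dual norm `‖·‖_{p'}`,
`1/p + 1/p' = 1`: all its subgradients are bounded by `K` in `‖·‖_{p'}`.  (For convex `f` this
is the same as `|f x - f y| ≤ K ‖x - y‖_p` for all `x, y`.) -/
def DualLipschitz {d : ℕ} (p K : ℝ) (f : Vec d → ℝ) : Prop :=
  ∀ x g : Vec d, IsSubgradient f x g → lpNorm p.conjExponent g ≤ K

/-- A loss function, together with the answers that a first-order oracle for it returns. -/
structure Loss (d : ℕ) where
  /-- the value at a point -/
  val : Vec d → ℝ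
  /-- the subgradient that the oracle returns at a point -/
  sub : Vec d → Vec d

/-- The loss is convex and its oracle returns subgradients. -/
def Loss.IsConvex {d : ℕ} (f : Loss d) : Prop :=
  ConvexOn ℝ Set.univ f.val ∧ ∀ x : Vec d, IsSubgradient f.val x (f.sub x)

/-- The zero loss. -/
def Loss.zero (d : ℕ) : Loss d := ⟨fun _ => 0, fun _ _ => 0⟩

/-! ### A randomized real-number machine with a step count

Programs manipulate natural-number registers (loop counters and indices) and arrays of real
numbers.  Exact arithmetic, comparison, `exp`, `log`, and powers of absolute values are unit-cost
operations on reals; there is no rounding operation, and no conversion from reals to integers.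
All loops are bounded loops. Fair coins can be tossed. -/

/-- Memory: `cnt x` is the natural-number register `x`, `arr a i` is entry `i` of the real array
`a`, and `pos` is the number of coins tossed so far. -/
structure State where
  cnt : ℕ → ℕ
  arr : ℕ → ℕ → ℝ
  pos : ℕ

/-- Set a natural-number register. -/
def State.setCnt (s : State) (x m : ℕ) : State :=
  ⟨Function.update s.cnt x m, s.arr, s.pos⟩

/-- Set an array entry. -/
def State.setArr (s : State) (a i : ℕ) (v : ℝ) : State :=
  ⟨s.cnt, Function.update s.arr a (Function.update (s.arr a) i v), s.pos⟩

/-- The first `d` entries of an array. -/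
def State.read (s : State) (d a : ℕ) : Vec d := fun i => s.arr a i

/-- Overwrite the first `d` entries of an array. -/
def State.write {d : ℕ} (s : State) (a : ℕ) (v : Vec d) : State :=
  ⟨s.cnt,
    Function.update s.arr a (fun i => if h : i < d then v ⟨i, h⟩ else s.arr a i), s.pos⟩

/-- Count one more coin toss. -/
def State.countToss (s : State) : State :=
  ⟨s.cnt, s.arr, s.pos + 1⟩

/-- Natural-number expressions (`sub` is truncated subtraction). -/
inductive NExp : Type
  | lit (m : ℕ)
  | reg (x : ℕ)
  | add (e₁ e₂ : NExp)
  | sub (e₁ e₂ : NExp)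
  | mul (e₁ e₂ : NExp)

/-- Value of a natural-number expression. -/
def NExp.eval (s : State) : NExp → ℕ
  | .lit m => m
  | .reg x => s.cnt x
  | .add e₁ e₂ => e₁.eval s + e₂.eval s
  | .sub e₁ e₂ => e₁.eval s - e₂.eval s
  | .mul e₁ e₂ => e₁.eval s * e₂.eval s

/-- Number of steps for evaluating a natural-number expression. -/
def NExp.cost : NExp → ℕ
  | .lit _ => 1
  | .reg _ => 1
  | .add e₁ e₂ => e₁.cost + e₂.cost + 1
  | .sub e₁ e₂ => e₁.cost + e₂.cost + 1
  | .mul e₁ e₂ => e₁.cost + e₂.cost + 1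

/-- Real expressions: rational literals, array entries, integers read as reals, arithmetic,
`exp`, `log`, the power `|a| ^ b`, and `lip e`, which looks up the Lipschitz constant that the
learner is given for the exponent `e`. -/
inductive RExp : Type
  | lit (q : ℚ)
  | cell (a : ℕ) (i : NExp)
  | ofNat (e : NExp)
  | add (e₁ e₂ : RExp)
  | sub (e₁ e₂ : RExp)
  | mul (e₁ e₂ : RExp)
  | div (e₁ e₂ : RExp)
  | exp (e : RExp)
  | log (e : RExp)
  | absPow (e₁ e₂ : RExp)
  | lip (e : RExp)

/-- Value of a real expression; `lip` is the table of Lipschitz constants. -/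
def RExp.eval (lip : ℝ → ℝ) (s : State) : RExp → ℝ
  | .lit q => (q : ℝ)
  | .cell a i => s.arr a (i.eval s)
  | .ofNat e => (e.eval s : ℝ)
  | .add e₁ e₂ => e₁.eval lip s + e₂.eval lip s
  | .sub e₁ e₂ => e₁.eval lip s - e₂.eval lip s
  | .mul e₁ e₂ => e₁.eval lip s * e₂.eval lip s
  | .div e₁ e₂ => e₁.eval lip s / e₂.eval lip s
  | .exp e => Real.exp (e.eval lip s)
  | .log e => Real.log (e.eval lip s)
  | .absPow e₁ e₂ => |e₁.eval lip s| ^ (e₂.eval lip s)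
  | .lip e => lip (e.eval lip s)

/-- Number of steps for evaluating a real expression. -/
def RExp.cost : RExp → ℕ
  | .lit _ => 1
  | .cell _ i => i.cost + 1
  | .ofNat e => e.cost + 1
  | .add e₁ e₂ => e₁.cost + e₂.cost + 1
  | .sub e₁ e₂ => e₁.cost + e₂.cost + 1
  | .mul e₁ e₂ => e₁.cost + e₂.cost + 1
  | .div e₁ e₂ => e₁.cost + e₂.cost + 1
  | .exp e => e.cost + 1
  | .log e => e.cost + 1
  | .absPow e₁ e₂ => e₁.cost + e₂.cost + 1
  | .lip e => e.cost + 1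

/-- Commands. `loop x e c` runs `c` with register `x` set to `0, 1, …, m - 1`, where `m` is the
value of `e` on entry. `toss a i` writes a fair random bit to an array entry. `query a b c` asks
the first-order oracle of the current loss about the point stored in array `a`: the value goes
to entry `0` of array `b`, and then the subgradient to array `c`. -/
inductive Cmd : Type
  | skip
  | seq (c₁ c₂ : Cmd)
  | setN (x : ℕ) (e : NExp)
  | setR (a : ℕ) (i : NExp) (e : RExp)
  | ifLt (e₁ e₂ : RExp) (c₁ c₂ : Cmd)
  | loop (x : ℕ) (e : NExp) (c : Cmd)
  | toss (a : ℕ) (i : NExp)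
  | query (a b c : ℕ)

/-- What a running program has access to besides its memory: the table of Lipschitz constants,
the current loss (by oracle queries only), and the sequence of coin tosses. -/
structure Env (d : ℕ) where
  lip : ℝ → ℝ
  loss : Loss d
  coins : ℕ → Bool

/-- Execution of a command: the final memory and the number of steps. An oracle query for a loss
on `ℝ^d` costs `d + 1` steps. -/
def Cmd.exec {d : ℕ} (E : Env d) : Cmd → State → State × ℕ
  | .skip, s => (s, 1)
  | .seq c₁ c₂, s =>
      let r₁ := c₁.exec E s
      let r₂ := c₂.exec E r₁.1
      (r₂.1, r₁.2 + r₂.2)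
  | .setN x e, s => (s.setCnt x (e.eval s), e.cost + 1)
  | .setR a i e, s => (s.setArr a (i.eval s) (e.eval E.lip s), i.cost + e.cost + 1)
  | .ifLt e₁ e₂ c₁ c₂, s =>
      let r := if e₁.eval E.lip s < e₂.eval E.lip s then c₁.exec E s else c₂.exec E s
      (r.1, r.2 + e₁.cost + e₂.cost + 1)
  | .loop x e c, s =>
      (List.range (e.eval s)).foldl
        (fun acc j =>
          let r := c.exec E (acc.1.setCnt x j)
          (r.1, acc.2 + r.2 + 1))
        (s, e.cost + 1)
  | .toss a i, s =>
      ((s.setArr a (i.eval s) (if E.coins s.pos then 1 else 0)).countToss, i.cost + 1)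
  | .query a b c, s =>
      let x := s.read d a
      ((s.setArr b 0 (E.loss.val x)).write c (E.loss.sub x), d + 1)

/-! ### Online convex optimization -/

/-- A strategy of nature: the next loss, as a function of the learner's past plays and of all
coins that the learner has tossed in the past rounds. -/
abbrev Nature (d : ℕ) : Type := List (Vec d) → List Bool → Loss d

/-- An online learning algorithm: `setup` is run once before the first round; in every round
`act` computes the next play, and `observe` is run once nature has selected the loss. -/
structure Learner where
  setup : Cmd
  act : Cmd
  observe : Cmd

namespace Learner

variable (A : Learner) (n d : ℕ) (δ : ℝ) (lip : ℝ → ℝ) (nature : Nature d) (ω : ℕ → Bool)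

/-- The initial memory: `n` in register `0`, `d` in register `1`, `δ` in entry `0` of array `0`,
and zeros everywhere else. -/
def start : State where
  cnt := fun x => if x = 0 then n else if x = 1 then d else 0
  arr := fun a i => if a = 0 ∧ i = 0 then δ else 0
  pos := 0

/-- While `setup` and `act` run, no information on the current loss is available. -/
def blindEnv : Env d := ⟨lip, Loss.zero d, ω⟩

/-- Memory after `setup`, and the number of steps of `setup`. -/
def runSetup : State × ℕ := A.setup.exec (blindEnv d lip ω) (start n d δ)

/-- Computation of the next play from the memory `s` at the start of a round. -/
def runAct (s : State) : State × ℕ := A.act.exec (blindEnv d lip ω) s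

/-- The play is the content of array `1` after `act`. -/
def playFrom (s : State) : Vec d := (A.runAct d lip ω s).1.read d 1

/-- Nature's choice of the loss, given the memory `s` at the start of the round and the past
plays `h`. -/
def lossFrom (s : State) (h : List (Vec d)) : Loss d := nature h ((List.range s.pos).map ω)

/-- Processing of the loss, after the play has been computed. -/
def runObserve (s : State) (h : List (Vec d)) : State × ℕ :=
  A.observe.exec ⟨lip, lossFrom d nature ω s h, ω⟩ (A.runAct d lip ω s).1

/-- Memory and list of past plays at the start of round `t` (rounds are counted from `0`). -/
def before : ℕ → State × List (Vec d)
  | 0 => ((A.runSetup n d δ lip ω).1, [])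
  | t + 1 =>
      let r := before t
      ((A.runObserve d lip nature ω r.1 r.2).1, r.2 ++ [A.playFrom d lip ω r.1])

/-- The learner's play in round `t`. -/
def play (t : ℕ) : Vec d :=
  A.playFrom d lip ω (A.before n d δ lip nature ω t).1

/-- Nature's loss in round `t`. -/
def loss (t : ℕ) : Loss d :=
  lossFrom d nature ω (A.before n d δ lip nature ω t).1 (A.before n d δ lip nature ω t).2

/-- Number of steps of the learner in round `t`. -/
def roundTime (t : ℕ) : ℕ :=
  (A.runAct d lip ω (A.before n d δ lip nature ω t).1).2 +
    (A.runObserve d lip nature ω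
      (A.before n d δ lip nature ω t).1 (A.before n d δ lip nature ω t).2).2

/-- Regret against the comparator `w` over `n` rounds, for the coin sequence `ω`. -/
def regret (w : Vec d) : ℝ :=
  ∑ t ∈ Finset.range n,
      (A.loss n d δ lip nature ω t).val (A.play n d δ lip nature ω t) -
    ∑ t ∈ Finset.range n, (A.loss n d δ lip nature ω t).val w

end Learner

/-- The law of a sequence of independent fair coins. -/
def coinMeasure : MeasureTheory.Measure (ℕ → Bool) :=
  MeasureTheory.Measure.infinitePi (fun _ : ℕ => (PMF.uniformOfFintype Bool).toMeasure)

/-- The table of Lipschitz constants available to the learner: the best constant for the exponent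
`p` that follows from the constants `L q`, `q ∈ [p, 2]`. (As `‖·‖_{q'}` increases with `q`, being
`L q`-Lipschitz w.r.t. `‖·‖_{q'}` implies the same w.r.t. `‖·‖_{p'}` for `p ≤ q`.) It equals `L p`
whenever `L` is nondecreasing. -/
def lipTable (L : ℝ → ℝ) (p : ℝ) : ℝ := sInf (L '' Set.Icc p 2)

end OnlineLp

end

/-!
The learner tosses no coins. On a grid of exponents `p`, it adds up the plays of one parameter-free
learner for each `p`, all fed with the subgradients `g_t` of the losses at the combined play.

*One exponent.* Let `q` be conjugate to `p`, let `L` bound `‖g_t‖_q`, and let `G_t` be minus the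
sum of the first `t` subgradients. The potential `ε exp (-t / 2n) exp (a_t ‖G_t‖_q²)`, where
`1 / a_t = 2 L² (9 (q - 1) n + t)`, decreases in every round at least by the linear loss
`⟨g_t, w_t⟩` of the play (`potential_step`). The reasons are that the squared `ℓ_q` norm is smooth with a
constant of order `q - 1` (`lpNorm_add_sq_le`), so that `‖G - g‖_q²` exceeds `‖G‖_q²` by at most a
linear function of `g` and `9 (q - 1) L²`; that the exponential of the linear function lies below
its chord; and that `cosh x ≤ exp (x² / 2)` is absorbed by the decay of `a_t`. Hence the cumulative
linear loss is at most `ε` minus the final potential (`sum_basePlay_le`). Against `w` this gives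
regret at most `ε` plus the Fenchel conjugate of `x ↦ ε exp (-1 / 2) exp (a_n x²)` at `‖w‖_p`, which
is of order `‖w‖_p √(log (1 + ‖w‖_p / (ε √a_n)) / a_n)` (`mul_sub_exp_sq_le`).

*All exponents.* As potentials are nonnegative, a learner of the grid costs at most its `ε` when
another one is the relevant one, and the `ε`s are chosen with sum at most `1`. The grid has mesh
`1 / (1 + log d)`. A given `p` is compared with the next grid point `p_j ≥ p`: there `‖w‖` and
`1 / (p_j - 1)` are no larger than at `p`, and the table of Lipschitz constants, looked up one mesh
lower, gives a constant that is valid after multiplication by `d ^ (1 / (1 + log d)) ≤ e` and is at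
most `e L_p` (`lpNorm_le_gridLip`, `exists_gridExp`). Since `p_j - 1 ≥ 1 / (1 + log d)` and
`1 / ε_j` is at most quadratic in `1 + log d`, only `log log d` enters the regret
(`base_bound_le`). For `n = 1` the bound vanishes at `w = 0` when all its factors are minimal, and
the play is `0`.

The plays are given by a closed formula in `G`, which is evaluated by a program with two nested
levels of loops over at most `d + 1` indices (`act_runs`, `observe_runs`).
-/

noncomputable section

namespace OnlineLp

open Finset

/-! ### The `ℓ_p` norms -/

theorem lpNorm_eq {d : ℕ} {p : ℝ} (hp : 0 < p) (x : Vec d) :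
    lpNorm p x = (∑ i, |x i| ^ p) ^ (1 / p) := by
  have h : (ENNReal.ofReal p).toReal = p := ENNReal.toReal_ofReal hp.le
  unfold lpNorm
  rw [PiLp.norm_eq_sum (by rw [h]; exact hp)]
  simp [h]

theorem sum_abs_rpow_nonneg {d : ℕ} (p : ℝ) (x : Vec d) : 0 ≤ ∑ i, |x i| ^ p :=
  sum_nonneg fun _ _ => Real.rpow_nonneg (abs_nonneg _) _

theorem lpNorm_nonneg {d : ℕ} {p : ℝ} (hp : 0 < p) (x : Vec d) : 0 ≤ lpNorm p x := by
  rw [lpNorm_eq hp]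
  exact Real.rpow_nonneg (sum_abs_rpow_nonneg p x) _

theorem lpNorm_rpow {d : ℕ} {p : ℝ} (hp : 0 < p) (x : Vec d) :
    lpNorm p x ^ p = ∑ i, |x i| ^ p := by
  rw [lpNorm_eq hp, ← Real.rpow_mul (sum_abs_rpow_nonneg p x), one_div_mul_cancel hp.ne',
    Real.rpow_one]

theorem lpNorm_neg {d : ℕ} {p : ℝ} (hp : 0 < p) (x : Vec d) : lpNorm p (-x) = lpNorm p x := by
  simp [lpNorm_eq hp]

theorem lpNorm_abs {d : ℕ} {p : ℝ} (hp : 0 < p) (x : Vec d) :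
    lpNorm p (fun i => |x i|) = lpNorm p x := by
  simp [lpNorm_eq hp]

theorem lpNorm_zero {d : ℕ} {p : ℝ} (hp : 0 < p) : lpNorm p (0 : Vec d) = 0 := by
  simp [lpNorm_eq hp, Real.zero_rpow hp.ne', Real.zero_rpow (inv_pos.2 hp).ne']

theorem lpNorm_add_le {d : ℕ} {p : ℝ} (hp : 1 ≤ p) (x y : Vec d) :
    lpNorm p (x + y) ≤ lpNorm p x + lpNorm p y := by
  have : Fact (1 ≤ ENNReal.ofReal p) := ⟨by simpa using ENNReal.ofReal_le_ofReal hp⟩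
  exact norm_add_le (WithLp.toLp (ENNReal.ofReal p) x : PiLp _ (fun _ : Fin d => ℝ))
    (WithLp.toLp (ENNReal.ofReal p) y)

theorem abs_le_lpNorm {d : ℕ} {p : ℝ} (hp : 0 < p) (x : Vec d) (i : Fin d) :
    |x i| ≤ lpNorm p x := by
  have h : |x i| ^ p ≤ lpNorm p x ^ p := by
    rw [lpNorm_rpow hp]
    exact single_le_sum (f := fun i => |x i| ^ p)
      (fun _ _ => Real.rpow_nonneg (abs_nonneg _) _) (mem_univ i)
  exact (Real.rpow_le_rpow_iff (abs_nonneg _) (lpNorm_nonneg hp x) hp).1 h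

/-- The `ℓ_p` norms decrease with the exponent. -/
theorem lpNorm_anti {d : ℕ} {p q : ℝ} (hp : 0 < p) (hpq : p ≤ q) (x : Vec d) :
    lpNorm q x ≤ lpNorm p x := by
  have hq : 0 < q := hp.trans_le hpq
  have hN := lpNorm_nonneg hp x
  rw [← Real.rpow_le_rpow_iff (lpNorm_nonneg hq x) hN hq, lpNorm_rpow hq]
  have key : ∀ i, |x i| ^ q ≤ lpNorm p x ^ (q - p) * |x i| ^ p := by
    intro i
    have h1 : |x i| ^ q = |x i| ^ (q - p) * |x i| ^ p := by
      rcases (abs_nonneg (x i)).eq_or_lt with h | h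
      · rw [← h, Real.zero_rpow hq.ne', Real.zero_rpow hp.ne', mul_zero]
      · rw [← Real.rpow_add h, sub_add_cancel]
    rw [h1]
    gcongr
    · exact abs_le_lpNorm hp x i
  calc ∑ i, |x i| ^ q ≤ ∑ i, lpNorm p x ^ (q - p) * |x i| ^ p := sum_le_sum fun i _ => key i
    _ = lpNorm p x ^ (q - p) * lpNorm p x ^ p := by rw [← mul_sum, lpNorm_rpow hp]
    _ = lpNorm p x ^ q := by
      rcases hN.eq_or_lt with h | h
      · rw [← h, Real.zero_rpow hq.ne', Real.zero_rpow hp.ne', mul_zero]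
      · rw [← Real.rpow_add h, sub_add_cancel]

/-- The reverse comparison of `ℓ_p` norms, with a power of the dimension. -/
theorem lpNorm_le_card_rpow_mul {d : ℕ} {p q : ℝ} (hp : 0 < p) (hpq : p ≤ q) (x : Vec d) :
    lpNorm p x ≤ (d : ℝ) ^ (1 / p - 1 / q) * lpNorm q x := by
  have hq : 0 < q := hp.trans_le hpq
  have hd : (0 : ℝ) ≤ d := Nat.cast_nonneg d
  have h := Real.rpow_sum_le_const_mul_sum_rpow_of_nonneg (s := univ)
    (f := fun i : Fin d => |x i| ^ p) (p := q / p) ((one_le_div hp).2 hpq)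
    (fun _ _ => Real.rpow_nonneg (abs_nonneg _) _)
  have h2 : ∀ i : Fin d, (|x i| ^ p) ^ (q / p) = |x i| ^ q := fun i => by
    rw [← Real.rpow_mul (abs_nonneg _), mul_div_cancel₀ _ hp.ne']
  simp only [h2, card_univ, Fintype.card_fin] at h
  have h3 := Real.rpow_le_rpow (Real.rpow_nonneg (sum_abs_rpow_nonneg p x) _) h
    (one_div_pos.2 hq).le
  rw [← Real.rpow_mul (sum_abs_rpow_nonneg p x), Real.mul_rpow (Real.rpow_nonneg hd _)
    (sum_abs_rpow_nonneg q x), ← Real.rpow_mul hd] at h3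
  rw [lpNorm_eq hp, lpNorm_eq hq]
  convert h3 using 3 <;> field_simp

/-- Hölder's inequality with powers: the exponents `α` and `β` add up to that of the norm. -/
theorem sum_rpow_mul_rpow_le {d : ℕ} {q α β : ℝ} (hα : 0 ≤ α) (hβ : 0 < β) (hq : α + β = q)
    (u v : Vec d) :
    ∑ i, |u i| ^ α * |v i| ^ β ≤ lpNorm q u ^ α * lpNorm q v ^ β := by
  have hq0 : 0 < q := by linarith
  rcases hα.eq_or_lt with h | h
  · subst h
    have : β = q := by linarith
    subst this
    simp [lpNorm_rpow hq0]
  · have hc : (q / α).HolderConjugate (q / β) := by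
      rw [Real.holderConjugate_iff]
      refine ⟨(one_lt_div h).2 (by linarith), ?_⟩
      field_simp
      exact hq
    have hol := Real.inner_le_Lp_mul_Lq_of_nonneg (s := univ) hc
      (f := fun i : Fin d => |u i| ^ α) (g := fun i => |v i| ^ β)
      (fun _ _ => Real.rpow_nonneg (abs_nonneg _) _)
      (fun _ _ => Real.rpow_nonneg (abs_nonneg _) _)
    have aux : ∀ (γ : ℝ), 0 < γ → ∀ x : Vec d,
        (∑ i, (|x i| ^ γ) ^ (q / γ)) ^ (1 / (q / γ)) = lpNorm q x ^ γ := by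
      intro γ hγ x
      have h2 : ∀ i : Fin d, (|x i| ^ γ) ^ (q / γ) = |x i| ^ q := fun i => by
        rw [← Real.rpow_mul (abs_nonneg _), mul_div_cancel₀ _ hγ.ne']
      simp only [h2]
      rw [← lpNorm_rpow hq0, ← Real.rpow_mul (lpNorm_nonneg hq0 x)]
      congr 1
      field_simp
    rwa [aux α h u, aux β hβ v] at hol

theorem conjExponent_holder {p : ℝ} (hp : 1 < p) : p.HolderConjugate p.conjExponent :=
  Real.HolderConjugate.conjExponent hp

/-- Hölder's inequality for a norm and its dual. -/
theorem sum_mul_le_lpNorm {d : ℕ} {p : ℝ} (hp : 1 < p) (u v : Vec d) :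
    ∑ i, u i * v i ≤ lpNorm p.conjExponent u * lpNorm p v := by
  have hc := conjExponent_holder hp
  rw [lpNorm_eq hc.symm.pos, lpNorm_eq hc.pos]
  exact Real.inner_le_Lp_mul_Lq univ u v hc.symm

/-! ### Smoothness of the squared `ℓ_q` norm, `q ≥ 2` -/

/-- The function `u ↦ |u| ^ (r - 1) * u` has Lipschitz constant `r * M ^ (r - 1)` on `[-M, M]`; this
is the case of nonnegative arguments, where it follows from Bernoulli's inequality. -/
theorem rpow_mul_sub_le {r M u v : ℝ} (hr : 1 ≤ r) (hv : 0 ≤ v) (hvu : v ≤ u) (hu : u ≤ M) :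
    u ^ (r - 1) * u - v ^ (r - 1) * v ≤ r * M ^ (r - 1) * (u - v) := by
  rcases (hv.trans hvu).eq_or_lt with h | h
  · have : v = 0 := by linarith
    simp [← h, this]
  · have e : ∀ x : ℝ, 0 ≤ x → x ^ (r - 1) * x = x ^ r := by
      intro x hx
      rcases hx.eq_or_lt with h0 | h0
      · rw [← h0, Real.zero_rpow (by linarith : r ≠ 0), mul_zero]
      · nth_rewrite 2 [← Real.rpow_one x]
        rw [← Real.rpow_add h0, sub_add_cancel]
    have hb := one_add_mul_self_le_rpow_one_add (s := v / u - 1)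
      (by have : 0 ≤ v / u := by positivity
          linarith) hr
    rw [add_sub_cancel, Real.div_rpow hv h.le, le_div_iff₀ (by positivity)] at hb
    have h1 : u ^ r - v ^ r ≤ r * u ^ (r - 1) * (u - v) := by
      have : (1 + r * (v / u - 1)) * u ^ r = u ^ r - r * u ^ (r - 1) * (u - v) := by
        rw [← e u h.le]; field_simp; ring
      linarith
    rw [e u h.le, e v hv]
    refine h1.trans ?_
    gcongr

theorem abs_rpow_mul_sub_le {r M u v : ℝ} (hr : 1 ≤ r) (hvu : v ≤ u) (hu : |u| ≤ M)
    (hv : |v| ≤ M) :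
    |u| ^ (r - 1) * u - |v| ^ (r - 1) * v ≤ r * M ^ (r - 1) * (u - v) := by
  have hM : 0 ≤ M := (abs_nonneg u).trans hu
  rcases le_total 0 v with h | h
  · rw [abs_of_nonneg h, abs_of_nonneg (h.trans hvu)]
    exact rpow_mul_sub_le hr h hvu ((le_abs_self u).trans hu)
  rcases le_total u 0 with h' | h'
  · rw [abs_of_nonpos h, abs_of_nonpos h']
    rw [abs_of_nonpos h] at hv
    have := rpow_mul_sub_le hr (neg_nonneg.2 h') (neg_le_neg hvu) hv
    linarith
  · have h1 : |u| ^ (r - 1) * u ≤ M ^ (r - 1) * u := by gcongr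
    have h2 : |v| ^ (r - 1) * (-v) ≤ M ^ (r - 1) * (-v) := by
      gcongr
      · linarith
    have h3 : 0 ≤ M ^ (r - 1) * (u - v) := mul_nonneg (by positivity) (by linarith)
    nlinarith

theorem abs_rpow_mul_sub_mul_le {r M u v : ℝ} (hr : 1 ≤ r) (hu : |u| ≤ M) (hv : |v| ≤ M) :
    (|u| ^ (r - 1) * u - |v| ^ (r - 1) * v) * (u - v) ≤ r * M ^ (r - 1) * (u - v) ^ 2 := by
  rcases le_total v u with h | h
  · nlinarith [mul_le_mul_of_nonneg_right (abs_rpow_mul_sub_le hr h hu hv) (sub_nonneg.2 h)]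
  · nlinarith [mul_le_mul_of_nonneg_right (abs_rpow_mul_sub_le hr h hv hu) (sub_nonneg.2 h)]

/-- A quadratic upper bound for `|a + b| ^ q`, from the mean value theorem and the Lipschitz bound
on the derivative. -/
theorem abs_add_rpow_le {q : ℝ} (hq : 2 ≤ q) (a b : ℝ) :
    |a + b| ^ q ≤ |a| ^ q + q * (|a| ^ (q - 2) * a) * b
      + q * (q - 1) * ((|a| + |b|) ^ (q - 2) * b ^ 2) := by
  have hder : ∀ s : ℝ, HasDerivAt (fun s : ℝ => |a + s * b| ^ q)
      (q * |a + s * b| ^ (q - 2) * (a + s * b) * b) s := by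
    intro s
    have h1 : HasDerivAt (fun s : ℝ => a + s * b) b s := by
      simpa using ((hasDerivAt_id s).mul_const b).const_add a
    exact (hasDerivAt_abs_rpow (a + s * b) (by linarith : 1 < q)).comp s h1
  obtain ⟨c, ⟨hc0, hc1⟩, hc⟩ := exists_hasDerivAt_eq_slope (fun s : ℝ => |a + s * b| ^ q) _
    zero_lt_one (fun s _ => (hder s).continuousAt.continuousWithinAt) (fun s _ => hder s)
  simp only [one_mul, zero_mul, add_zero, sub_zero, div_one] at hc
  have hM1 : |a + c * b| ≤ |a| + |b| := by
    refine (abs_add_le _ _).trans ?_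
    rw [abs_mul, abs_of_pos hc0]
    nlinarith [abs_nonneg b]
  have hM2 : |a| ≤ |a| + |b| := by linarith [abs_nonneg b]
  have key := abs_rpow_mul_sub_mul_le (r := q - 1) (by linarith) hM1 hM2
  have e : q - 1 - 1 = q - 2 := by ring
  rw [e, add_sub_cancel_left] at key
  have hpow : 0 ≤ (|a| + |b|) ^ (q - 2) * b ^ 2 := by positivity
  have key2 : (|a + c * b| ^ (q - 2) * (a + c * b) - |a| ^ (q - 2) * a) * b
      ≤ c * ((q - 1) * ((|a| + |b|) ^ (q - 2) * b ^ 2)) := by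
    have : c * ((|a + c * b| ^ (q - 2) * (a + c * b) - |a| ^ (q - 2) * a) * b)
        ≤ c * (c * ((q - 1) * ((|a| + |b|) ^ (q - 2) * b ^ 2))) := by
      nlinarith [key]
    exact le_of_mul_le_mul_left this hc0
  have key3 : c * ((q - 1) * ((|a| + |b|) ^ (q - 2) * b ^ 2))
      ≤ 1 * ((q - 1) * ((|a| + |b|) ^ (q - 2) * b ^ 2)) := by
    have : 0 ≤ (q - 1) * ((|a| + |b|) ^ (q - 2) * b ^ 2) := mul_nonneg (by linarith) hpow
    gcongr
  have := mul_le_mul_of_nonneg_left (key2.trans key3) (by linarith : 0 ≤ q)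
  linarith

/-- The gradient of `x ↦ ‖x‖_q ^ q / q`. -/
def powGrad {d : ℕ} (q : ℝ) (x : Vec d) : Vec d := fun i => |x i| ^ (q - 2) * x i

theorem abs_powGrad {d : ℕ} {q : ℝ} (hq : 2 ≤ q) (x : Vec d) (i : Fin d) :
    |powGrad q x i| = |x i| ^ (q - 1) := by
  unfold powGrad
  rw [abs_mul, abs_of_nonneg (Real.rpow_nonneg (abs_nonneg _) _)]
  rcases (abs_nonneg (x i)).eq_or_lt with h | h
  · rw [← h, Real.zero_rpow (by linarith : q - 1 ≠ 0), mul_zero]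
  · nth_rewrite 2 [← Real.rpow_one |x i|]
    rw [← Real.rpow_add h]
    congr 1
    ring

theorem abs_sum_powGrad_mul_le {d : ℕ} {q : ℝ} (hq : 2 ≤ q) (x y : Vec d) :
    |∑ i, powGrad q x i * y i| ≤ lpNorm q x ^ (q - 1) * lpNorm q y := by
  have h := sum_rpow_mul_rpow_le (q := q) (α := q - 1) (β := 1) (by linarith) one_pos (by ring) x y
  simp only [Real.rpow_one] at h
  refine (abs_sum_le_sum_abs _ _).trans ?_
  simpa only [abs_mul, abs_powGrad hq] using h

theorem lpNorm_add_rpow_le {d : ℕ} {q : ℝ} (hq : 2 ≤ q) (x y : Vec d) :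
    lpNorm q (x + y) ^ q ≤ lpNorm q x ^ q + q * ∑ i, powGrad q x i * y i
      + q * (q - 1) * ((lpNorm q x + lpNorm q y) ^ (q - 2) * lpNorm q y ^ 2) := by
  have hq0 : 0 < q := by linarith
  have h1 : ∑ i, (|x i| + |y i|) ^ (q - 2) * y i ^ 2
      ≤ (lpNorm q x + lpNorm q y) ^ (q - 2) * lpNorm q y ^ 2 := by
    have h := sum_rpow_mul_rpow_le (q := q) (α := q - 2) (β := 2) (by linarith) two_pos (by ring)
      ((fun i => |x i|) + (fun i => |y i|)) y
    have hN := lpNorm_add_le (p := q) (by linarith) (fun i => |x i|) (fun i => |y i|)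
    rw [lpNorm_abs hq0, lpNorm_abs hq0] at hN
    simp only [Pi.add_apply, Real.rpow_two, sq_abs] at h
    have e : ∀ i, |(|x i| + |y i|)| = |x i| + |y i| := fun i => abs_of_nonneg (by positivity)
    simp only [e] at h
    refine h.trans ?_
    gcongr
    · exact lpNorm_nonneg hq0 _
  have h2 : ∑ i, |(x + y) i| ^ q ≤ ∑ i, (|x i| ^ q + q * (|x i| ^ (q - 2) * x i) * y i
      + q * (q - 1) * ((|x i| + |y i|) ^ (q - 2) * y i ^ 2)) :=
    sum_le_sum fun i _ => abs_add_rpow_le hq (x i) (y i)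
  rw [lpNorm_rpow hq0, lpNorm_rpow hq0]
  refine h2.trans ?_
  rw [sum_add_distrib, sum_add_distrib, ← mul_sum]
  have h3 : ∑ i, q * (|x i| ^ (q - 2) * x i) * y i = q * ∑ i, powGrad q x i * y i := by
    rw [mul_sum]
    exact sum_congr rfl fun i _ => by unfold powGrad; ring
  rw [h3]
  have : 0 ≤ q * (q - 1) := mul_nonneg hq0.le (by linarith)
  gcongr

/-- The squared `ℓ_q` norm is smooth, with a constant proportional to `q - 1`.  For `y` small
compared with `x` this follows from the expansion of `‖x + y‖_q ^ q` and the concavity of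
`z ↦ z ^ (2 / q)`; otherwise the triangle inequality suffices. -/
theorem lpNorm_add_sq_le {d : ℕ} {q : ℝ} (hq : 2 ≤ q) (x y : Vec d) :
    lpNorm q (x + y) ^ 2 ≤ lpNorm q x ^ 2
      + 2 * lpNorm q x ^ (2 - q) * ∑ i, powGrad q x i * y i
      + 9 * (q - 1) * lpNorm q y ^ 2 := by
  have hq0 : 0 < q := by linarith
  have hNy := lpNorm_nonneg hq0 y
  have htri := lpNorm_add_le (p := q) (by linarith) x y
  have hNxy := lpNorm_nonneg hq0 (x + y)
  have hHol := abs_sum_powGrad_mul_le hq x y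
  have hexp := lpNorm_add_rpow_le hq x y
  rcases (lpNorm_nonneg hq0 x).eq_or_lt with h0 | hx
  · rw [← h0, Real.zero_rpow (by linarith : q - 1 ≠ 0), zero_mul] at hHol
    have hz : ∑ i, powGrad q x i * y i = 0 := abs_nonpos_iff.1 hHol
    rw [hz, ← h0]
    rw [← h0, zero_add] at htri
    nlinarith [sq_nonneg (lpNorm q y)]
  set X := lpNorm q x with hX
  set Y := lpNorm q y with hY
  set S := ∑ i, powGrad q x i * y i with hS
  have hXX : X ^ (2 - q) * X ^ (q - 1) = X := by
    rw [← Real.rpow_add hx]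
    norm_num
  have hS1 : -(X * Y) ≤ X ^ (2 - q) * S := by
    have h1 : -(X ^ (q - 1) * Y) ≤ S := (abs_le.1 hHol).1
    have h2 := mul_le_mul_of_nonneg_left h1 (Real.rpow_nonneg hx.le (2 - q))
    have : X ^ (2 - q) * -(X ^ (q - 1) * Y) = -(X * Y) := by
      rw [mul_neg, ← mul_assoc, hXX]
    linarith
  by_cases hsmall : q * Y ≤ X
  · set Z := lpNorm q (x + y) with hZ
    have hXq : 0 < X ^ q := Real.rpow_pos_of_pos hx q
    -- Bernoulli's inequality for the exponent `2 / q`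
    have hbern : Z ^ 2 ≤ X ^ 2 + 2 / q * X ^ (2 - q) * (Z ^ q - X ^ q) := by
      have hb := rpow_one_add_le_one_add_mul_self (s := Z ^ q / X ^ q - 1)
        (by have : 0 ≤ Z ^ q / X ^ q := by positivity
            linarith) (p := 2 / q) (by positivity) ((div_le_one hq0).2 hq)
      rw [add_sub_cancel, Real.div_rpow (by positivity) hXq.le, ← Real.rpow_mul hNxy,
        ← Real.rpow_mul hx.le, mul_div_cancel₀ _ hq0.ne', Real.rpow_two, Real.rpow_two,
        div_le_iff₀ (by positivity)] at hb
      have e : X ^ (2 - q) = X ^ 2 / X ^ q := by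
        rw [Real.rpow_sub hx, Real.rpow_two]
      rw [e]
      refine hb.trans_eq ?_
      field_simp
    have hpow : (X + Y) ^ (q - 2) ≤ 3 * X ^ (q - 2) := by
      have h1 : X + Y ≤ X * (1 + 1 / q) := by
        have : Y ≤ X / q := by rw [le_div_iff₀ hq0]; linarith
        rw [mul_add, mul_one, mul_one_div]
        linarith
      have h2 : (1 + 1 / q) ^ (q - 2) ≤ 3 := by
        have h3 : 1 + 1 / q ≤ Real.exp (1 / q) := by
          linarith [Real.add_one_le_exp (1 / q)]
        calc (1 + 1 / q) ^ (q - 2) ≤ Real.exp (1 / q) ^ (q - 2) :=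
              Real.rpow_le_rpow (by positivity) h3 (by linarith)
          _ = Real.exp (1 / q * (q - 2)) := (Real.exp_mul _ _).symm
          _ ≤ Real.exp 1 := by
              apply Real.exp_le_exp.2
              rw [one_div, inv_mul_le_iff₀ hq0]
              linarith
          _ ≤ 3 := by linarith [Real.exp_one_lt_d9]
      calc (X + Y) ^ (q - 2) ≤ (X * (1 + 1 / q)) ^ (q - 2) :=
            Real.rpow_le_rpow (by positivity) h1 (by linarith)
        _ = X ^ (q - 2) * (1 + 1 / q) ^ (q - 2) := Real.mul_rpow hx.le (by positivity)
        _ ≤ X ^ (q - 2) * 3 := by gcongr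
        _ = 3 * X ^ (q - 2) := mul_comm _ _
    have hXX2 : X ^ (2 - q) * X ^ (q - 2) = 1 := by
      rw [← Real.rpow_add hx]
      norm_num
    have hZq : Z ^ q - X ^ q ≤ q * S + q * (q - 1) * (3 * X ^ (q - 2) * Y ^ 2) := by
      have h0 : 0 ≤ q * (q - 1) := mul_nonneg hq0.le (by linarith)
      have : q * (q - 1) * ((X + Y) ^ (q - 2) * Y ^ 2)
          ≤ q * (q - 1) * (3 * X ^ (q - 2) * Y ^ 2) := by gcongr
      linarith
    have h5 : 2 / q * X ^ (2 - q) * (Z ^ q - X ^ q)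
        ≤ 2 / q * X ^ (2 - q) * (q * S + q * (q - 1) * (3 * X ^ (q - 2) * Y ^ 2)) := by
      gcongr
    have h6 : 2 / q * X ^ (2 - q) * (q * S + q * (q - 1) * (3 * X ^ (q - 2) * Y ^ 2))
        = 2 * X ^ (2 - q) * S + 6 * (q - 1) * (X ^ (2 - q) * X ^ (q - 2)) * Y ^ 2 := by
      field_simp
      ring
    rw [h6, hXX2] at h5
    nlinarith [mul_nonneg (by linarith : 0 ≤ q - 1) (sq_nonneg Y)]
  · push Not at hsmall
    have h1 : X * Y ≤ q * Y * Y := by gcongr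
    have h2 : q * (Y * Y) ≤ 2 * (q - 1) * (Y * Y) := by
      have := mul_nonneg hNy hNy
      nlinarith
    have h3 : lpNorm q (x + y) ^ 2 ≤ (X + Y) ^ 2 := by gcongr
    nlinarith [mul_nonneg hNy hNy]

/-! ### The potential -/

/-- The chord of `exp` over a symmetric interval lies above its graph. -/
theorem exp_mul_le_cosh_add {a u U : ℝ} (hu : |u| ≤ U) :
    Real.exp (a * u) ≤ Real.cosh (a * U) + u * (Real.sinh (a * U) / U) := by
  rcases ((abs_nonneg u).trans hu).eq_or_lt with h | h
  · have : u = 0 := abs_nonpos_iff.1 (h ▸ hu)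
    simp [← h, this]
  · obtain ⟨h1, h2⟩ := abs_le.1 hu
    have h3 : -1 ≤ u / U := by rw [le_div_iff₀ h]; linarith
    have h4 : u / U ≤ 1 := by rw [div_le_iff₀ h]; linarith
    have hc := convexOn_exp.2 (Set.mem_univ (a * U)) (Set.mem_univ (-(a * U)))
      (show 0 ≤ (1 + u / U) / 2 by linarith) (show 0 ≤ (1 - u / U) / 2 by linarith) (by ring)
    simp only [smul_eq_mul] at hc
    have e : (1 + u / U) / 2 * (a * U) + (1 - u / U) / 2 * -(a * U) = a * u := by
      field_simp
      ring
    rw [e] at hc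
    refine hc.trans_eq ?_
    rw [Real.cosh_eq, Real.sinh_eq]
    ring

/-- The learner for one exponent and one Lipschitz constant plays this multiple of
`powGrad q G` when `N = ‖G‖_q`; `a` is the rate of the potential after the round. -/
def stepSize (a q L N : ℝ) : ℝ :=
  Real.exp (a * N ^ 2) * (Real.sinh (2 * a * N * L) / L) * N ^ (1 - q)

/-- One round of the potential: `κ` pays for the curvature of `‖·‖_q²`, and the decrease of the rate
from `a` to `a'` pays for `cosh`. -/
theorem exp_potential_step {d : ℕ} {q L a a' κ : ℝ} (hq : 2 ≤ q) (hL : 0 < L) (ha' : 0 ≤ a')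
    (haa' : a' * (1 + 2 * a' * L ^ 2) ≤ a) (hκ : a' * (9 * (q - 1) * L ^ 2) ≤ κ)
    (G g : Vec d) (hg : lpNorm q g ≤ L) :
    Real.exp (-κ) * Real.exp (a' * lpNorm q (G - g) ^ 2) ≤
      Real.exp (a * lpNorm q G ^ 2)
        - ∑ i, g i * (stepSize a' q L (lpNorm q G) * powGrad q G i) := by
  have hq0 : 0 < q := by linarith
  have hgN := lpNorm_nonneg hq0 g
  have hsm := lpNorm_add_sq_le hq G (-g)
  rw [← sub_eq_add_neg, lpNorm_neg hq0] at hsm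
  have hHol := abs_sum_powGrad_mul_le hq G (-g)
  rw [lpNorm_neg hq0] at hHol
  have hN := lpNorm_nonneg hq0 G
  set N := lpNorm q G with hNdef
  set S := ∑ i, powGrad q G i * (-g) i with hS
  set u := 2 * N ^ (2 - q) * S with hu
  have hS' : ∑ i, g i * (stepSize a' q L N * powGrad q G i) = -(stepSize a' q L N * S) := by
    rw [hS, mul_sum, ← sum_neg_distrib]
    exact sum_congr rfl fun i _ => by rw [Pi.neg_apply]; ring
  have huU : |u| ≤ 2 * N * L := by
    rw [hu, abs_mul, abs_of_nonneg (by positivity)]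
    rcases hN.eq_or_lt with h | h
    · rw [← h, Real.zero_rpow (by linarith : q - 1 ≠ 0), zero_mul] at hHol
      rw [le_antisymm hHol (abs_nonneg _), ← h]
      simp
    · calc 2 * N ^ (2 - q) * |S| ≤ 2 * N ^ (2 - q) * (N ^ (q - 1) * L) := by
            gcongr
            exact hHol.trans (by gcongr)
        _ = 2 * (N ^ (2 - q) * N ^ (q - 1)) * L := by ring
        _ = 2 * N * L := by rw [← Real.rpow_add h]; norm_num
  have hcoef : Real.exp (a' * N ^ 2) * (u * (Real.sinh (a' * (2 * N * L)) / (2 * N * L)))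
      = stepSize a' q L N * S := by
    rcases hN.eq_or_lt with h | h
    · simp [stepSize, ← h]
    · have e : N ^ (2 - q) = N ^ (1 - q) * N := by
        nth_rewrite 3 [← Real.rpow_one N]
        rw [← Real.rpow_add h]
        congr 1
        ring
      have e2 : a' * (2 * N * L) = 2 * a' * N * L := by ring
      rw [hu, e, e2, stepSize]
      field_simp
  have hcosh : Real.exp (a' * N ^ 2) * Real.cosh (a' * (2 * N * L)) ≤ Real.exp (a * N ^ 2) := by
    calc Real.exp (a' * N ^ 2) * Real.cosh (a' * (2 * N * L))
        ≤ Real.exp (a' * N ^ 2) * Real.exp ((a' * (2 * N * L)) ^ 2 / 2) := by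
          gcongr
          exact Real.cosh_le_exp_half_sq _
      _ = Real.exp (a' * (1 + 2 * a' * L ^ 2) * N ^ 2) := by
          rw [← Real.exp_add]
          congr 1
          ring
      _ ≤ Real.exp (a * N ^ 2) := by gcongr
  have hexp := mul_le_mul_of_nonneg_left (exp_mul_le_cosh_add (a := a') huU)
    (Real.exp_pos (a' * N ^ 2)).le
  rw [mul_add, hcoef] at hexp
  rw [hS']
  have hfirst : Real.exp (-κ) * Real.exp (a' * lpNorm q (G - g) ^ 2)
      ≤ Real.exp (a' * N ^ 2) * Real.exp (a' * u) := by
    rw [← Real.exp_add, ← Real.exp_add]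
    apply Real.exp_le_exp.2
    have h1 : 9 * (q - 1) * lpNorm q g ^ 2 ≤ 9 * (q - 1) * L ^ 2 := by
      have : 0 ≤ 9 * (q - 1) := by linarith
      gcongr
    have h2 := mul_le_mul_of_nonneg_left (hsm.trans (add_le_add_right h1 _)) ha'
    linarith
  linarith

/-- The rate of the potential after `t` of `n` rounds. -/
def rate (n : ℕ) (q L t : ℝ) : ℝ := 1 / (2 * L ^ 2 * (9 * (q - 1) * n + t))

/-- The potential after `t` of `n` rounds, with initial value `ε` at `G = 0`. -/
def potential {d : ℕ} (n : ℕ) (q L ε t : ℝ) (G : Vec d) : ℝ :=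
  ε * (Real.exp (-(t / (2 * n))) * Real.exp (rate n q L t * lpNorm q G ^ 2))

/-- The play, in round `t` of `n`, of the learner for the exponent `q` and the Lipschitz constant
`L`; `-G` is the sum of the subgradients of the past rounds. -/
def basePlay {d : ℕ} (n : ℕ) (q L ε t : ℝ) (G : Vec d) : Vec d := fun i =>
  ε * Real.exp (-(t / (2 * n))) * stepSize (rate n q L (t + 1)) q L (lpNorm q G) * powGrad q G i

theorem potential_step {d n : ℕ} {q L ε t : ℝ} (hn : 0 < n) (hq : 2 ≤ q) (hL : 0 < L)
    (hε : 0 ≤ ε) (ht : 0 ≤ t) (G g : Vec d) (hg : lpNorm q g ≤ L) :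
    potential n q L ε (t + 1) (G - g) ≤
      potential n q L ε t G - ∑ i, g i * basePlay n q L ε t G i := by
  have hn' : (0 : ℝ) < n := by exact_mod_cast hn
  have hK : 0 < 9 * (q - 1) := by linarith
  have hs : 0 < 9 * (q - 1) * n + t := by positivity
  have hs' : 0 < 9 * (q - 1) * n + (t + 1) := by positivity
  have h := exp_potential_step (κ := 1 / (2 * n)) (a := rate n q L t) (a' := rate n q L (t + 1))
    hq hL (by unfold rate; positivity)
    (by
      unfold rate
      have e : 1 / (2 * L ^ 2 * (9 * (q - 1) * ↑n + (t + 1))) *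
          (1 + 2 * (1 / (2 * L ^ 2 * (9 * (q - 1) * ↑n + (t + 1)))) * L ^ 2)
          = ((9 * (q - 1) * n + t) + 2) / (2 * L ^ 2 * (9 * (q - 1) * n + (t + 1)) ^ 2) := by
        field_simp
        ring
      rw [e, div_le_div_iff₀ (by positivity) (by positivity)]
      have : 0 ≤ 2 * L ^ 2 := by positivity
      nlinarith)
    (by
      unfold rate
      rw [div_mul_eq_mul_div, one_mul, div_le_div_iff₀ (by positivity) (by positivity)]
      have : 0 ≤ 2 * L ^ 2 := by positivity
      nlinarith) G g hg
  have e1 : Real.exp (-((t + 1) / (2 * n)))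
      = Real.exp (-(t / (2 * n))) * Real.exp (-(1 / (2 * n))) := by
    rw [← Real.exp_add]
    congr 1
    ring
  have e2 : ∑ i, g i * basePlay n q L ε t G i = ε * Real.exp (-(t / (2 * n))) *
      ∑ i, g i * (stepSize (rate n q L (t + 1)) q L (lpNorm q G) * powGrad q G i) := by
    rw [mul_sum]
    exact sum_congr rfl fun i _ => by unfold basePlay; ring
  have h2 := mul_le_mul_of_nonneg_left h
    (mul_nonneg hε (Real.exp_pos (-(t / (2 * n)))).le)
  unfold potential
  rw [e1, e2]
  linarith

/-- Minus the sum of the first `t` vectors. -/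
def negSum {d : ℕ} (g : ℕ → Vec d) (t : ℕ) : Vec d := fun i => -∑ s ∈ range t, g s i

theorem negSum_succ {d : ℕ} (g : ℕ → Vec d) (t : ℕ) : negSum g (t + 1) = negSum g t - g t := by
  funext i
  simp only [negSum, sum_range_succ, Pi.sub_apply]
  ring

/-- The cumulative linear loss is bounded by the initial minus the final potential. -/
theorem sum_basePlay_le {d n : ℕ} {q L ε : ℝ} (hn : 0 < n) (hq : 2 ≤ q) (hL : 0 < L)
    (hε : 0 ≤ ε) (g : ℕ → Vec d) (hg : ∀ t < n, lpNorm q (g t) ≤ L) :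
    ∑ t ∈ range n, ∑ i, g t i * basePlay n q L ε t (negSum g t) i
      ≤ ε - potential n q L ε n (negSum g n) := by
  have key : ∀ m ≤ n, ∑ t ∈ range m, ∑ i, g t i * basePlay n q L ε t (negSum g t) i
      ≤ ε - potential n q L ε m (negSum g m) := by
    intro m
    induction m with
    | zero =>
      intro _
      have h0 : negSum g 0 = 0 := by funext i; simp [negSum]
      simp [potential, h0, lpNorm_zero (d := d) (p := q) (by linarith)]
    | succ m ih =>
      intro hm
      have h1 := ih (by omega)
      have h2 := potential_step (t := m) hn hq hL hε (Nat.cast_nonneg m) (negSum g m) (g m)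
        (hg m (by omega))
      rw [sum_range_succ, negSum_succ]
      push_cast
      linarith
  exact key n le_rfl

/-- An upper bound on the Fenchel conjugate of `x ↦ ε * exp (a * x ^ 2)`. -/
theorem mul_sub_exp_sq_le {W ε a x : ℝ} (hW : 0 ≤ W) (hε : 0 < ε) (ha : 0 < a) (hx : 0 ≤ x) :
    W * x - ε * Real.exp (a * x ^ 2)
      ≤ W * Real.sqrt (2 / a * Real.log (1 + W / (ε * Real.sqrt a))) := by
  have hsa : 0 < Real.sqrt a := Real.sqrt_pos.2 ha
  by_cases h : x ≤ Real.sqrt (2 / a * Real.log (1 + W / (ε * Real.sqrt a)))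
  · have := mul_le_mul_of_nonneg_left h hW
    have := mul_pos hε (Real.exp_pos (a * x ^ 2))
    linarith
  · push Not at h
    have hlog := (Real.sqrt_lt' ((Real.sqrt_nonneg _).trans_lt h)).1 h
    have h1 : Real.log (1 + W / (ε * Real.sqrt a)) ≤ a * x ^ 2 / 2 := by
      have := mul_le_mul_of_nonneg_left hlog.le ha.le
      have e : a * (2 / a * Real.log (1 + W / (ε * Real.sqrt a)))
        = 2 * Real.log (1 + W / (ε * Real.sqrt a)) := by field_simp
      linarith
    have h2 : W / (ε * Real.sqrt a) ≤ Real.exp (a * x ^ 2 / 2) := by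
      have h3 := (Real.log_le_iff_le_exp (by positivity)).1 h1
      linarith
    have h4 : Real.sqrt a * x ≤ Real.exp (a * x ^ 2 / 2) := by
      have h5 := Real.add_one_le_exp (a * x ^ 2 / 2)
      have h6 : (Real.sqrt a * x) ^ 2 = a * x ^ 2 := by rw [mul_pow, Real.sq_sqrt ha.le]
      nlinarith [sq_nonneg (Real.sqrt a * x - 1)]
    have h7 : W * x ≤ ε * Real.exp (a * x ^ 2) := by
      have h8 := mul_le_mul h2 h4 (by positivity) (Real.exp_pos _).le
      rw [← Real.exp_add, add_halves] at h8
      have e : W / (ε * Real.sqrt a) * (Real.sqrt a * x) = W * x / ε := by field_simp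
      rw [e, div_le_iff₀ hε] at h8
      linarith
    have : 0 ≤ W * Real.sqrt (2 / a * Real.log (1 + W / (ε * Real.sqrt a))) := by positivity
    linarith

/-! ### A grid of exponents -/

/-- The inverse mesh of the grid of exponents. -/
def gridLen (d : ℕ) : ℝ := 1 + Real.log d

/-- The exponents of the grid: `1 + 1 / gridLen d` and up with spacing `1 / gridLen d`,
capped at `2`. -/
def gridExp (d j : ℕ) : ℝ := min 2 (1 + (j + 1) / gridLen d)

/-- The exponent, one mesh below `gridExp d j`, at which the Lipschitz constant for the `j`-th
learner is looked up; `1 + δ` is the least exponent at which the table means anything. -/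
def gridLookup (d : ℕ) (δ : ℝ) (j : ℕ) : ℝ := max (1 + δ) (gridExp d j - 1 / gridLen d)

/-- The Lipschitz constant used by the `j`-th learner. -/
def gridLip (lip : ℝ → ℝ) (d : ℕ) (δ : ℝ) (j : ℕ) : ℝ := Real.exp 1 * lip (gridLookup d δ j)

/-- The initial value of the potential of the `j`-th learner. -/
def gridWeight (j : ℕ) : ℝ := 1 / ((j + 1) * (j + 2))

/-- The play of the combined learner: the sum of the plays of the learners of the grid. -/
def gridPlay (lip : ℝ → ℝ) {d : ℕ} (n : ℕ) (δ : ℝ) (t : ℕ) (G : Vec d) : Vec d := fun i =>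
  ∑ j ∈ range (d + 1),
    basePlay n (gridExp d j).conjExponent (gridLip lip d δ j) (gridWeight j) t G i

theorem one_le_gridLen (d : ℕ) : 1 ≤ gridLen d := by
  unfold gridLen
  linarith [Real.log_natCast_nonneg d]

theorem gridLen_pos (d : ℕ) : 0 < gridLen d := one_pos.trans_le (one_le_gridLen d)

theorem gridLen_le (d : ℕ) : gridLen d ≤ d + 1 := by
  unfold gridLen
  linarith [Real.log_le_self (Nat.cast_nonneg (α := ℝ) d)]

theorem gridLen_le_two_mul_max (d : ℕ) : gridLen d ≤ 2 * max 1 (Real.log d) := by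
  unfold gridLen
  linarith [le_max_left 1 (Real.log d), le_max_right 1 (Real.log d)]

theorem natCast_rpow_le_exp_one {d : ℕ} {s : ℝ} (hs : 0 ≤ s) (hs' : s ≤ 1 / gridLen d) :
    (d : ℝ) ^ s ≤ Real.exp 1 := by
  rcases Nat.eq_zero_or_pos d with h | h
  · subst h
    refine (Real.rpow_le_one (by simp) (by simp) hs).trans ?_
    exact Real.one_le_exp zero_le_one
  · have hd : (0 : ℝ) < d := by exact_mod_cast h
    rw [Real.rpow_def_of_pos hd]
    apply Real.exp_le_exp.2
    have h1 := mul_le_mul_of_nonneg_left hs' (Real.log_natCast_nonneg d)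
    refine h1.trans ?_
    rw [mul_one_div, div_le_one (gridLen_pos d)]
    unfold gridLen
    linarith

theorem gridExp_le_two (d j : ℕ) : gridExp d j ≤ 2 := min_le_left _ _

theorem one_div_gridLen_le (d j : ℕ) : 1 / gridLen d ≤ gridExp d j - 1 := by
  have h1 := one_le_gridLen d
  have h0 := gridLen_pos d
  unfold gridExp
  rw [le_sub_iff_add_le, le_min_iff]
  constructor
  · have : 1 / gridLen d ≤ 1 := (div_le_one h0).2 h1
    linarith
  · have : 1 / gridLen d ≤ (j + 1) / gridLen d := by
      gcongr
      linarith [Nat.cast_nonneg (α := ℝ) j]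
    linarith

theorem one_lt_gridExp (d j : ℕ) : 1 < gridExp d j := by
  have := one_div_gridLen_le d j
  have : 0 < 1 / gridLen d := one_div_pos.2 (gridLen_pos d)
  linarith

theorem conjExponent_sub_one {p : ℝ} (hp : 1 < p) : p.conjExponent - 1 = 1 / (p - 1) := by
  unfold Real.conjExponent
  have : p - 1 ≠ 0 := by linarith
  field_simp
  ring

theorem two_le_conjExponent {p : ℝ} (hp : 1 < p) (hp2 : p ≤ 2) : 2 ≤ p.conjExponent := by
  have h := conjExponent_sub_one hp
  have : 1 ≤ 1 / (p - 1) := (one_le_div (by linarith)).2 (by linarith)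
  linarith

theorem conjExponent_anti {p r : ℝ} (hp : 1 < p) (hpr : p ≤ r) :
    r.conjExponent ≤ p.conjExponent := by
  have h1 := conjExponent_sub_one hp
  have h2 := conjExponent_sub_one (hp.trans_le hpr)
  have : 1 / (r - 1) ≤ 1 / (p - 1) := one_div_le_one_div_of_le (by linarith) (by linarith)
  linarith

theorem one_div_conjExponent {p : ℝ} (hp : 1 < p) : 1 / p.conjExponent = 1 - 1 / p := by
  unfold Real.conjExponent
  have : p - 1 ≠ 0 := by linarith
  field_simp

theorem gridLookup_mem {δ : ℝ} (hδ1 : δ ≤ 1) (d j : ℕ) :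
    gridLookup d δ j ∈ Set.Icc (1 + δ) 2 := by
  refine ⟨le_max_left _ _, max_le (by linarith) ?_⟩
  have : 0 < 1 / gridLen d := one_div_pos.2 (gridLen_pos d)
  linarith [gridExp_le_two d j]

theorem lipTable_le {L : ℝ → ℝ} {δ r p : ℝ} (hL : ∀ p ∈ Set.Icc (1 + δ) 2, 1 ≤ L p)
    (hr : 1 + δ ≤ r) (hp : p ∈ Set.Icc r 2) : lipTable L r ≤ L p := by
  apply csInf_le
  · refine ⟨1, ?_⟩
    rintro _ ⟨q, hq, rfl⟩
    exact hL q ⟨hr.trans hq.1, hq.2⟩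
  · exact ⟨p, hp, rfl⟩

theorem le_lipTable {L : ℝ → ℝ} {r c : ℝ} (hr : r ≤ 2) (h : ∀ p ∈ Set.Icc r 2, c ≤ L p) :
    c ≤ lipTable L r := by
  apply le_csInf
  · exact ⟨L 2, 2, ⟨hr, le_rfl⟩, rfl⟩
  · rintro _ ⟨q, hq, rfl⟩
    exact h q hq

theorem one_le_gridLip {L : ℝ → ℝ} {δ : ℝ} (hδ1 : δ ≤ 1)
    (hL : ∀ p ∈ Set.Icc (1 + δ) 2, 1 ≤ L p) (d j : ℕ) : 1 ≤ gridLip (lipTable L) d δ j := by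
  obtain ⟨h1, h2⟩ := gridLookup_mem hδ1 d j
  have h3 : 1 ≤ lipTable L (gridLookup d δ j) :=
    le_lipTable h2 fun p hp => hL p ⟨h1.trans hp.1, hp.2⟩
  exact one_le_mul_of_one_le_of_one_le (Real.one_le_exp zero_le_one) h3

/-- The constant of the `j`-th learner is valid: passing from the exponent of the look-up to that
of the learner costs a factor of at most `d ^ (1 / gridLen d) ≤ e`. -/
theorem lpNorm_le_gridLip {L : ℝ → ℝ} {δ : ℝ} (hδ : 0 < δ) (hδ1 : δ ≤ 1) {d : ℕ} (j : ℕ)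
    {g : Vec d} (hg : ∀ p ∈ Set.Icc (1 + δ) 2, lpNorm p.conjExponent g ≤ L p) :
    lpNorm (gridExp d j).conjExponent g ≤ gridLip (lipTable L) d δ j := by
  obtain ⟨h1, h2⟩ := gridLookup_mem hδ1 d j
  have hr1 : 1 < gridLookup d δ j := by linarith
  have hp1 := one_lt_gridExp d j
  set r := gridLookup d δ j with hr
  have hpos : ∀ {p : ℝ}, 1 < p → 0 < p.conjExponent := fun h => (conjExponent_holder h).symm.pos
  have hlook : lpNorm r.conjExponent g ≤ lipTable L r :=
    le_lipTable h2 fun p hp =>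
      (lpNorm_anti (hpos (hr1.trans_le hp.1)) (conjExponent_anti hr1 hp.1) g).trans
        (hg p ⟨h1.trans hp.1, hp.2⟩)
  have hN := lpNorm_nonneg (hpos hr1) g
  have hcmp : lpNorm (gridExp d j).conjExponent g ≤ Real.exp 1 * lpNorm r.conjExponent g := by
    rcases le_total (gridExp d j) r with h | h
    · exact (lpNorm_anti (hpos hr1) (conjExponent_anti hp1 h) g).trans
        (le_mul_of_one_le_left hN (Real.one_le_exp zero_le_one))
    · refine (lpNorm_le_card_rpow_mul (hpos hp1) (conjExponent_anti hr1 h) g).trans ?_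
      refine mul_le_mul_of_nonneg_right (natCast_rpow_le_exp_one ?_ ?_) hN
      · rw [one_div_conjExponent hp1, one_div_conjExponent hr1]
        have := one_div_le_one_div_of_le (by linarith) h
        linarith
      · rw [one_div_conjExponent hp1, one_div_conjExponent hr1]
        have hrp : gridExp d j - r ≤ 1 / gridLen d := by
          have : gridExp d j - 1 / gridLen d ≤ r := le_max_right _ _
          linarith
        have e : 1 - 1 / gridExp d j - (1 - 1 / r) = (gridExp d j - r) / (gridExp d j * r) := by
          field_simp
          ring
        rw [e]
        refine le_trans (div_le_self (by linarith) ?_) hrp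
        nlinarith
  refine hcmp.trans ?_
  exact mul_le_mul_of_nonneg_left hlook (Real.exp_pos 1).le

/-- Every exponent has a grid point just above it. -/
theorem exists_gridExp {δ p : ℝ} (hδ : 0 < δ) (d : ℕ) (hp : p ∈ Set.Icc (1 + δ) 2) :
    ∃ j < d + 1, (j : ℝ) < gridLen d ∧ p ≤ gridExp d j ∧ gridLookup d δ j ≤ p := by
  have h0 := gridLen_pos d
  have hx : 0 < (p - 1) * gridLen d := mul_pos (by linarith [hp.1]) h0
  have hceil : 0 < ⌈(p - 1) * gridLen d⌉₊ := Nat.ceil_pos.2 hx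
  obtain ⟨j, hj⟩ := Nat.exists_eq_succ_of_ne_zero hceil.ne'
  have h1 : (p - 1) * gridLen d ≤ j + 1 := by
    have := Nat.le_ceil ((p - 1) * gridLen d)
    rw [hj] at this
    exact_mod_cast this
  have h2 : (j : ℝ) < (p - 1) * gridLen d := by
    apply Nat.lt_ceil.1
    omega
  have h3 : (j : ℝ) < gridLen d := h2.trans_le (by nlinarith [hp.2])
  refine ⟨j, ?_, h3, ?_, ?_⟩
  · have := h3.trans_le (gridLen_le d)
    exact_mod_cast this
  · refine le_min hp.2 ?_
    have : p - 1 ≤ (j + 1) / gridLen d := by rwa [le_div_iff₀ h0]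
    linarith
  · refine max_le hp.1 ?_
    have h4 : gridExp d j ≤ 1 + (j + 1) / gridLen d := min_le_right _ _
    have h5 : (j : ℝ) / gridLen d < p - 1 := by rwa [div_lt_iff₀ h0]
    rw [add_div] at h4
    linarith

theorem sum_gridWeight (m : ℕ) : ∑ j ∈ range m, gridWeight j = 1 - 1 / (m + 1) := by
  induction m with
  | zero => simp
  | succ m ih =>
    rw [sum_range_succ, ih, gridWeight]
    push_cast
    field_simp
    ring

/-! ### Regret of the combined learner -/

theorem one_div_rate_le {n : ℕ} {q Lg Lp : ℝ} (hq : 2 ≤ q) (hLg : 1 ≤ Lg)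
    (hLgp : Lg ≤ Real.exp 1 * Lp) (hLp : 1 ≤ Lp) :
    1 / rate n q Lg n ≤ 160 * Lp ^ 2 * ((q - 1) * n) := by
  have hn0 : (0 : ℝ) ≤ n := Nat.cast_nonneg n
  have he8 : Real.exp 1 < 2.8 := by linarith [Real.exp_one_lt_d9]
  have hLgp' : Lg ≤ 2.8 * Lp := hLgp.trans (by gcongr)
  rw [rate, one_div_one_div]
  have hq1 : 0 ≤ q - 1 := by linarith
  have h2 : 9 * (q - 1) * n + n ≤ 10 * ((q - 1) * n) := by nlinarith
  calc 2 * Lg ^ 2 * (9 * (q - 1) * n + n)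
      ≤ 2 * (2.8 * Lp) ^ 2 * (10 * ((q - 1) * n)) := by gcongr
    _ = 156.8 * (Lp ^ 2 * ((q - 1) * n)) := by ring
    _ ≤ 160 * (Lp ^ 2 * ((q - 1) * n)) := by gcongr; norm_num
    _ = 160 * Lp ^ 2 * ((q - 1) * n) := by ring

theorem one_div_sqrt_le {n Lp M κ a : ℝ} (hn : 1 ≤ n) (hLp : 1 ≤ Lp) (hM : 1 ≤ M)
    (hκ : κ ≤ 2 * M) (ha : 1 / a ≤ 160 * Lp ^ 2 * (κ * n)) :
    1 / Real.sqrt a ≤ 26 * (Lp * M * n) := by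
  have h1 : 1 / Real.sqrt a = Real.sqrt (1 / a) := by
    rw [Real.sqrt_div zero_le_one, Real.sqrt_one]
  rw [h1, Real.sqrt_le_left (by positivity)]
  refine ha.trans ?_
  have h3 : 1 ≤ M * n := one_le_mul_of_one_le_of_one_le hM hn
  calc 160 * Lp ^ 2 * (κ * n) ≤ 160 * Lp ^ 2 * (2 * M * n) := by gcongr
    _ = 320 * Lp ^ 2 * (M * n) := by ring
    _ ≤ 676 * Lp ^ 2 * ((M * n) * (M * n)) :=
      mul_le_mul (by nlinarith [sq_nonneg Lp]) (le_mul_of_one_le_left (by linarith) h3)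
        (by linarith) (by positivity)
    _ = (26 * (Lp * M * n)) ^ 2 := by ring

theorem one_div_gridWeight_le {d j : ℕ} (hj : (j : ℝ) < gridLen d) :
    1 / gridWeight j ≤ 24 * max 1 (Real.log d) ^ 2 := by
  have hlM := gridLen_le_two_mul_max d
  have hl1 := one_le_gridLen d
  rw [gridWeight, one_div_one_div]
  calc ((j : ℝ) + 1) * (j + 2) ≤ (2 * gridLen d) * (3 * gridLen d) := by gcongr <;> linarith
    _ = 6 * gridLen d ^ 2 := by ring
    _ ≤ 6 * (2 * max 1 (Real.log d)) ^ 2 := by gcongr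
    _ = 24 * max 1 (Real.log d) ^ 2 := by ring

/-- The argument of the logarithm in the regret of one learner is polynomial in that of the target
bound. The lower bound `2` on the latter absorbs numerical factors. -/
theorem one_add_div_le_pow {n Lp M W w ε a Q : ℝ} (hn : 2 ≤ n) (hLp : 1 ≤ Lp) (hM : 1 ≤ M)
    (hW : 0 ≤ W) (hWw : W ≤ w) (hε : 0 < ε) (hε' : 1 / ε ≤ 72 * M ^ 2)
    (ha' : 1 / Real.sqrt a ≤ 26 * (Lp * M * n)) (hQ : Q = (w + 1) * Lp * M * n) :
    2 ≤ Q ∧ 1 + W / (ε * Real.sqrt a) ≤ Q ^ 14 := by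
  have hw0 : 0 ≤ w := hW.trans hWw
  have hLM : 1 ≤ Lp * M := one_le_mul_of_one_le_of_one_le hLp hM
  have hLMn : 2 ≤ Lp * M * n := by
    calc (2 : ℝ) = 1 * 2 := by norm_num
      _ ≤ Lp * M * n := by gcongr
  have hQe : Q = w * Lp * M * n + Lp * M * n := by rw [hQ]; ring
  have hwn : 0 ≤ w * Lp * M * n := by positivity
  have hQ2 : 2 ≤ Q := by linarith
  refine ⟨hQ2, ?_⟩
  have hMn : M ≤ Lp * M * n := by
    calc M = 1 * M * 1 := by ring
      _ ≤ Lp * M * n := by gcongr; linarith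
  have hMQ : M ≤ Q := by linarith
  have e : W / (ε * Real.sqrt a) = W * (1 / ε) * (1 / Real.sqrt a) := by
    rw [mul_assoc, one_div_mul_one_div_rev, mul_one_div, mul_comm (Real.sqrt a)]
  have h1 : W * (1 / ε) * (1 / Real.sqrt a) ≤ w * (72 * M ^ 2) * (26 * (Lp * M * n)) := by gcongr
  have h3 : w * (72 * M ^ 2) * (26 * (Lp * M * n)) ≤ 1872 * Q ^ 2 * (Q - 2) := by
    calc w * (72 * M ^ 2) * (26 * (Lp * M * n)) = 1872 * M ^ 2 * (w * Lp * M * n) := by ring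
      _ ≤ 1872 * Q ^ 2 * (Q - 2) := by gcongr; linarith
  have h4 : (2 : ℝ) ^ 11 ≤ Q ^ 11 := by gcongr
  have h5 : (2 : ℝ) ^ 11 * Q ^ 3 ≤ Q ^ 11 * Q ^ 3 := by gcongr
  have h6 : (0 : ℝ) ≤ Q ^ 3 := by positivity
  have h7 : (2 : ℝ) ^ 2 ≤ Q ^ 2 := by gcongr
  have h8 : Q ^ 11 * Q ^ 3 = Q ^ 14 := by ring
  have h9 : 1872 * Q ^ 2 * (Q - 2) = 1872 * Q ^ 3 - 3744 * Q ^ 2 := by ring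
  rw [e]
  linarith

theorem one_add_mul_sqrt_le {n Lp M W w ε a κ p : ℝ} (hn : 2 ≤ n) (hLp : 1 ≤ Lp) (hM : 1 ≤ M)
    (hW : 0 ≤ W) (hWw : W ≤ w) (hε : 0 < ε) (hε' : 1 / ε ≤ 72 * M ^ 2) (ha : 0 < a)
    (ha' : 1 / a ≤ 160 * Lp ^ 2 * (κ * n)) (hp1 : 1 ≤ 1 / (p - 1)) (hκp : κ ≤ 1 / (p - 1))
    (hκM : κ ≤ 2 * M) :
    1 + W * Real.sqrt (2 / a * Real.log (1 + W / (ε * Real.sqrt a)))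
      ≤ 67 * ((w + 1) * Lp * Real.sqrt (n * Real.log ((w + 1) * Lp * M * n) / (p - 1))) := by
  have hw0 : 0 ≤ w := hW.trans hWw
  have hn0 : 0 < n := by linarith
  obtain ⟨Q, hQ⟩ : ∃ Q, Q = (w + 1) * Lp * M * n := ⟨_, rfl⟩
  obtain ⟨hQ2, harg⟩ := one_add_div_le_pow hn hLp hM hW hWw hε hε'
    (one_div_sqrt_le (by linarith) hLp hM hκM ha') hQ
  have hlogQ : 1 / 2 ≤ Real.log Q := by
    have h1 := Real.log_two_gt_d9
    have h2 := Real.log_le_log two_pos hQ2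
    linarith
  rw [← hQ]
  have hRarg : n * Real.log Q / (p - 1) = 1 / (p - 1) * (n * Real.log Q) := by ring
  have hnlog : 1 ≤ n * Real.log Q := by nlinarith
  have hbig : 1 ≤ 1 / (p - 1) * (n * Real.log Q) := one_le_mul_of_one_le_of_one_le hp1 hnlog
  rw [hRarg]
  set R := Real.sqrt (1 / (p - 1) * (n * Real.log Q)) with hR
  have hRsq : R ^ 2 = 1 / (p - 1) * (n * Real.log Q) := Real.sq_sqrt (by linarith)
  have hR1 : 1 ≤ R := by rwa [hR, Real.one_le_sqrt]
  have hfrac : 0 ≤ W / (ε * Real.sqrt a) := by positivity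
  set Y := Real.log (1 + W / (ε * Real.sqrt a)) with hY
  have hY0 : 0 ≤ Y := Real.log_nonneg (by linarith)
  have hlog : Y ≤ 14 * Real.log Q := by
    have h1 := Real.log_le_log (by linarith) harg
    rw [Real.log_pow] at h1
    exact_mod_cast h1
  have hX : Real.sqrt (2 / a * Y) ≤ 67 * Lp * R := by
    rw [Real.sqrt_le_left (by positivity), mul_pow, hRsq]
    have h2 : 2 / a ≤ 320 * Lp ^ 2 * (1 / (p - 1) * n) := by
      calc 2 / a = 2 * (1 / a) := by ring
        _ ≤ 2 * (160 * Lp ^ 2 * (κ * n)) := by gcongr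
        _ ≤ 2 * (160 * Lp ^ 2 * (1 / (p - 1) * n)) := by gcongr
        _ = 320 * Lp ^ 2 * (1 / (p - 1) * n) := by ring
    calc 2 / a * Y ≤ 320 * Lp ^ 2 * (1 / (p - 1) * n) * (14 * Real.log Q) := by gcongr
      _ = 4480 * (Lp ^ 2 * (1 / (p - 1) * (n * Real.log Q))) := by ring
      _ ≤ 4489 * (Lp ^ 2 * (1 / (p - 1) * (n * Real.log Q))) := by gcongr; norm_num
      _ = (67 * Lp) ^ 2 * (1 / (p - 1) * (n * Real.log Q)) := by ring
  have hWX := mul_le_mul hWw hX (Real.sqrt_nonneg _) hw0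
  have hfin : 1 ≤ Lp * R := one_le_mul_of_one_le_of_one_le hLp hR1
  linarith

/-- The regret bound of one learner of the grid, in terms of the target quantities. -/
theorem base_bound_le {n d j : ℕ} {p x W w Lg Lp : ℝ} (hn : 2 ≤ n) (hj : (j : ℝ) < gridLen d)
    (hp : 1 < p) (hpg : p ≤ gridExp d j) (hW : 0 ≤ W) (hWw : W ≤ w) (hLp : 1 ≤ Lp)
    (hLg : 1 ≤ Lg) (hLgp : Lg ≤ Real.exp 1 * Lp) (hx : 0 ≤ x) :
    1 + (W * x - gridWeight j * (Real.exp (-((n : ℝ) / (2 * n))) *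
        Real.exp (rate n (gridExp d j).conjExponent Lg n * x ^ 2)))
      ≤ 67 * ((w + 1) * Lp *
        Real.sqrt (n * Real.log ((w + 1) * Lp * max 1 (Real.log d) * n) / (p - 1))) := by
  have hn2 : (2 : ℝ) ≤ n := by exact_mod_cast hn
  have hn0 : (0 : ℝ) < n := by linarith
  have hg1 := one_lt_gridExp d j
  have hg2 := gridExp_le_two d j
  have hq := conjExponent_sub_one hg1
  have hq2 := two_le_conjExponent hg1 hg2
  have hε : 0 < gridWeight j * Real.exp (-((n : ℝ) / (2 * n))) :=
    mul_pos (by unfold gridWeight; positivity) (Real.exp_pos _)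
  have ha : 0 < rate n (gridExp d j).conjExponent Lg n := by
    have : 0 < (gridExp d j).conjExponent - 1 := by linarith
    unfold rate
    positivity
  have hmain := mul_sub_exp_sq_le hW hε ha hx
  rw [mul_assoc] at hmain
  have hε' : 1 / (gridWeight j * Real.exp (-((n : ℝ) / (2 * n))))
      ≤ 72 * max 1 (Real.log d) ^ 2 := by
    have hhalf : (n : ℝ) / (2 * n) = 1 / 2 := by field_simp
    have h1 : (Real.exp (-(1 / 2 : ℝ)))⁻¹ ≤ 3 := by
      rw [Real.exp_neg, inv_inv]
      have : Real.exp (1 / 2) ≤ Real.exp 1 := Real.exp_le_exp.2 (by norm_num)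
      linarith [Real.exp_one_lt_d9]
    have h2 := one_div_gridWeight_le hj
    rw [hhalf, one_div, mul_inv, ← one_div]
    calc 1 / gridWeight j * (Real.exp (-(1 / 2 : ℝ)))⁻¹ ≤ 24 * max 1 (Real.log d) ^ 2 * 3 := by
          gcongr
      _ = 72 * max 1 (Real.log d) ^ 2 := by ring
  have hfin := one_add_mul_sqrt_le (p := p) hn2 hLp (le_max_left 1 (Real.log d)) hW hWw hε hε' ha
    (one_div_rate_le hq2 hLg hLgp hLp) ((one_le_div (by linarith)).2 (by linarith))
    (hq.trans_le (one_div_le_one_div_of_le (by linarith) (by linarith)))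
    (by
      rw [hq]
      refine le_trans ?_ (gridLen_le_two_mul_max d)
      rw [one_div_le (by linarith) (gridLen_pos d)]
      exact one_div_gridLen_le d j)
  linarith

/-- The Lipschitz bound on the loss difference between `0` and a point of norm `x` implies the bound
for one round, although the logarithm tends to `0` with `x` when `Lp` and the dimension term
are `1`. -/
theorem mul_le_of_one_round {d : ℕ} {p x Lp : ℝ} (hp : 1 < p) (hp2 : p ≤ 2) (hx : 0 ≤ x)
    (hLp : 1 ≤ Lp) :
    Lp * x ≤ 67 * ((x + 1) * Lp *
      Real.sqrt ((1 : ℕ) * Real.log ((x + 1) * Lp * max 1 (Real.log d) * (1 : ℕ)) / (p - 1))) := by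
  have hM1 : 1 ≤ max 1 (Real.log d) := le_max_left _ _
  have hp1 : 1 ≤ 1 / (p - 1) := (one_le_div (by linarith)).2 (by linarith)
  have h1 : x / (x + 1) ≤ Real.log (x + 1) := by
    have h := Real.one_sub_inv_le_log_of_pos (by linarith : 0 < x + 1)
    have e : 1 - (x + 1)⁻¹ = x / (x + 1) := by field_simp; ring
    linarith
  have h2 : Real.log (x + 1) ≤ Real.log ((x + 1) * Lp * max 1 (Real.log d)) := by
    apply Real.log_le_log (by linarith)
    calc x + 1 = (x + 1) * 1 * 1 := by ring
      _ ≤ _ := by gcongr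
  have h3 : x / (x + 1) ≤ Real.sqrt
      ((1 : ℕ) * Real.log ((x + 1) * Lp * max 1 (Real.log d) * (1 : ℕ)) / (p - 1)) := by
    apply Real.le_sqrt_of_sq_le
    simp only [Nat.cast_one, mul_one, one_mul]
    have h4 : x / (x + 1) ≤ 1 := (div_le_one (by linarith)).2 (by linarith)
    have h5 : 0 ≤ x / (x + 1) := by positivity
    have h6 : (x / (x + 1)) ^ 2 ≤ Real.log ((x + 1) * Lp * max 1 (Real.log d)) := by nlinarith
    have h9 : 0 ≤ Real.log ((x + 1) * Lp * max 1 (Real.log d)) := (sq_nonneg _).trans h6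
    rw [div_eq_mul_one_div (Real.log _)]
    nlinarith
  have h7 : (x + 1) * Lp * (x / (x + 1)) = Lp * x := by field_simp
  have h8 := mul_le_mul_of_nonneg_left h3 (by positivity : 0 ≤ (x + 1) * Lp)
  rw [h7] at h8
  have h9 : 0 ≤ Lp * x := by positivity
  linarith

theorem gridPlay_zero (lip : ℝ → ℝ) {d : ℕ} (n : ℕ) (δ : ℝ) (t : ℕ) :
    gridPlay lip n δ t (0 : Vec d) = 0 := by
  funext i
  simp [gridPlay, basePlay, powGrad]

/-- The regret of the combined learner for linear losses. -/
theorem sum_gridPlay_le {L : ℝ → ℝ} {δ : ℝ} (hδ : 0 < δ) (hδ1 : δ ≤ 1)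
    (hL : ∀ p ∈ Set.Icc (1 + δ) 2, 1 ≤ L p) {n d : ℕ} (g : ℕ → Vec d)
    (hg : ∀ t < n, ∀ p ∈ Set.Icc (1 + δ) 2, lpNorm p.conjExponent (g t) ≤ L p)
    (w : Vec d) {p : ℝ} (hp : p ∈ Set.Icc (1 + δ) 2) :
    ∑ t ∈ range n, ∑ i, g t i * (gridPlay (lipTable L) n δ t (negSum g t) i - w i)
      ≤ 67 * ((lpNorm p w + 1) * L p *
        Real.sqrt (n * Real.log ((lpNorm p w + 1) * L p * max 1 (Real.log d) * n) / (p - 1))) := by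
  have hp1 : 1 < p := by linarith [hp.1]
  have hpN := lpNorm_nonneg (by linarith : 0 < p) w
  obtain rfl | rfl | hn : n = 0 ∨ n = 1 ∨ 2 ≤ n := by omega
  · simp
  · -- with a single round the bound may vanish at `w = 0`, but the play is `0`
    have h0 : negSum g 0 = 0 := by funext i; simp [negSum]
    have h1 := sum_mul_le_lpNorm hp1 (g 0) (-w)
    rw [lpNorm_neg (by linarith)] at h1
    have h2 := mul_le_mul_of_nonneg_right (hg 0 one_pos p hp) hpN
    rw [sum_range_one, h0, gridPlay_zero]
    refine le_trans ?_ (mul_le_of_one_round hp1 hp.2 hpN (hL p hp))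
    simpa using h1.trans h2
  obtain ⟨j, hj, hjl, hpj, hjp⟩ := exists_gridExp hδ d hp
  set q := fun j => (gridExp d j).conjExponent with hq
  have hq2 : ∀ j, 2 ≤ q j := fun j =>
    two_le_conjExponent (one_lt_gridExp d j) (gridExp_le_two d j)
  have hLg := one_le_gridLip hδ1 hL d
  have hw0 : ∀ j, 0 ≤ gridWeight j := fun j => by unfold gridWeight; positivity
  have hbase : ∀ j, ∑ t ∈ range n, ∑ i, g t i * basePlay n (q j) (gridLip (lipTable L) d δ j)
      (gridWeight j) t (negSum g t) i
      ≤ gridWeight j - potential n (q j) (gridLip (lipTable L) d δ j) (gridWeight j) n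
        (negSum g n) := fun j =>
    sum_basePlay_le (by omega) (hq2 j) (by linarith [hLg j]) (hw0 j) g
      fun t ht => lpNorm_le_gridLip hδ hδ1 j (hg t ht)
  have hpot : ∀ j, 0 ≤ potential n (q j) (gridLip (lipTable L) d δ j) (gridWeight j) n
      (negSum g n) := fun j =>
    mul_nonneg (hw0 j) (mul_nonneg (Real.exp_pos _).le (Real.exp_pos _).le)
  have hsplit : ∑ t ∈ range n, ∑ i, g t i * (gridPlay (lipTable L) n δ t (negSum g t) i - w i)
      = ∑ j ∈ range (d + 1), ∑ t ∈ range n, ∑ i, g t i * basePlay n (q j)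
        (gridLip (lipTable L) d δ j) (gridWeight j) t (negSum g t) i
        + ∑ i, negSum g n i * w i := by
    have e1 : ∑ i, negSum g n i * w i = -∑ t ∈ range n, ∑ i, g t i * w i := by
      rw [sum_comm, ← sum_neg_distrib]
      refine sum_congr rfl fun i _ => ?_
      rw [negSum, neg_mul, sum_mul]
    rw [e1, ← sub_eq_add_neg, sum_comm (s := range (d + 1)), ← sum_sub_distrib]
    refine sum_congr rfl fun t _ => ?_
    rw [sum_comm, ← sum_sub_distrib]
    refine sum_congr rfl fun i _ => ?_
    rw [gridPlay, mul_sub, mul_sum]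
  have hpotj := single_le_sum (f := fun j => potential n (q j) (gridLip (lipTable L) d δ j)
    (gridWeight j) n (negSum g n)) (fun j _ => hpot j) (mem_range.2 hj)
  have hsum : ∑ j ∈ range (d + 1), ∑ t ∈ range n, ∑ i, g t i * basePlay n (q j)
        (gridLip (lipTable L) d δ j) (gridWeight j) t (negSum g t) i
      ≤ 1 - potential n (q j) (gridLip (lipTable L) d δ j) (gridWeight j) n (negSum g n) := by
    refine (sum_le_sum fun j _ => hbase j).trans ?_
    rw [sum_sub_distrib, sum_gridWeight]
    have : (0 : ℝ) ≤ 1 / ((d + 1 : ℕ) + 1) := by positivity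
    linarith
  have hHol := sum_mul_le_lpNorm (one_lt_gridExp d j) (negSum g n) w
  have hfin := base_bound_le (n := n) (x := lpNorm (q j) (negSum g n)) hn hjl hp1 hpj
    (lpNorm_nonneg (by linarith [one_lt_gridExp d j]) w)
    (lpNorm_anti (by linarith) hpj w) (hL p hp) (hLg j)
    (mul_le_mul_of_nonneg_left (lipTable_le hL (le_max_left _ _) ⟨hjp, hp.2⟩)
      (Real.exp_pos 1).le) (lpNorm_nonneg (by linarith [hq2 j]) _)
  rw [hsplit]
  unfold potential at hsum
  linarith

/-! ### Reasoning about programs -/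

/-- Run from `s`, the command `c` takes at most `B` steps and ends in a state satisfying `P`. -/
def Runs {d : ℕ} (E : Env d) (c : Cmd) (s : State) (B : ℕ) (P : State → Prop) : Prop :=
  P (c.exec E s).1 ∧ (c.exec E s).2 ≤ B

theorem Runs.seq {d : ℕ} {E : Env d} {c₁ c₂ : Cmd} {s : State} {B₁ B₂ : ℕ} {P Q : State → Prop}
    (h₁ : Runs E c₁ s B₁ P) (h₂ : ∀ s', P s' → Runs E c₂ s' B₂ Q) :
    Runs E (.seq c₁ c₂) s (B₁ + B₂) Q :=
  ⟨(h₂ _ h₁.1).1, Nat.add_le_add h₁.2 (h₂ _ h₁.1).2⟩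

theorem Runs.loop {d : ℕ} {E : Env d} {x m B : ℕ} {e : NExp} {c : Cmd} {s : State}
    (I : ℕ → State → Prop) (hm : e.eval s = m) (h0 : I 0 s)
    (hstep : ∀ j < m, ∀ s, I j s → Runs E c (s.setCnt x j) B (I (j + 1))) :
    Runs E (.loop x e c) s (e.cost + 1 + m * (B + 1)) (I m) := by
  have key : ∀ k ≤ m,
      I k ((List.range k).foldl (fun acc j =>
        ((c.exec E (State.setCnt acc.1 x j)).1,
          acc.2 + (c.exec E (State.setCnt acc.1 x j)).2 + 1)) (s, e.cost + 1)).1 ∧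
      ((List.range k).foldl (fun acc j =>
        ((c.exec E (State.setCnt acc.1 x j)).1,
          acc.2 + (c.exec E (State.setCnt acc.1 x j)).2 + 1)) (s, e.cost + 1)).2
        ≤ e.cost + 1 + k * (B + 1) := by
    intro k
    induction k with
    | zero => intro _; exact ⟨h0, by simp⟩
    | succ k ih =>
      intro hk
      obtain ⟨h1, h2⟩ := ih (by omega)
      obtain ⟨h3, h4⟩ := hstep k (by omega) _ h1
      rw [List.range_succ, List.foldl_append, List.foldl_cons, List.foldl_nil]
      refine ⟨h3, ?_⟩
      rw [add_mul, one_mul]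
      dsimp only
      omega
  subst hm
  exact key _ le_rfl

theorem Runs.setR {d : ℕ} {E : Env d} {a : ℕ} {i : NExp} {e : RExp} {s : State}
    {P : State → Prop} (h : P (s.setArr a (i.eval s) (e.eval E.lip s))) :
    Runs E (.setR a i e) s (i.cost + e.cost + 1) P := ⟨h, le_rfl⟩

theorem Runs.setN {d : ℕ} {E : Env d} {x : ℕ} {e : NExp} {s : State}
    {P : State → Prop} (h : P (s.setCnt x (e.eval s))) :
    Runs E (.setN x e) s (e.cost + 1) P := ⟨h, le_rfl⟩

theorem State.setCnt_cnt (s : State) (x m y : ℕ) :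
    (s.setCnt x m).cnt y = if y = x then m else s.cnt y := by
  simp [State.setCnt, Function.update_apply]

theorem State.setArr_arr (s : State) (a i : ℕ) (v : ℝ) (b k : ℕ) :
    (s.setArr a i v).arr b k = if b = a ∧ k = i then v else s.arr b k := by
  by_cases hb : b = a
  · subst hb
    simp [State.setArr, Function.update_apply]
  · simp [State.setArr, hb]

theorem State.write_arr {d : ℕ} (s : State) (a : ℕ) (v : Vec d) (b k : ℕ) :
    (s.write a v).arr b k =
      if b = a then (if h : k < d then v ⟨k, h⟩ else s.arr a k) else s.arr b k := by
  by_cases hb : b = a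
  · subst hb
    simp [State.write]
  · simp [State.write, hb]

/-! ### The program

Register `0` holds `n`, register `1` holds `d`, register `2` counts the points of the grid,
register `3` the coordinates and register `4` the rounds. Array `1` holds the play, array `2`
minus the sum of the past subgradients, entry `0` of array `3` the sum `∑ |G i| ^ q`, and arrays
`4` and `5` receive the answers of the oracle. -/

/-- `min e₁ e₂`, as `(e₁ + e₂ - |e₁ - e₂|) / 2`. -/
def minE (e₁ e₂ : RExp) : RExp :=
  .div (.sub (.add e₁ e₂) (.absPow (.sub e₁ e₂) (.lit 1))) (.lit 2)

/-- `max e₁ e₂`, as `(e₁ + e₂ + |e₁ - e₂|) / 2`. -/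
def maxE (e₁ e₂ : RExp) : RExp :=
  .div (.add (.add e₁ e₂) (.absPow (.sub e₁ e₂) (.lit 1))) (.lit 2)

/-- The expression for `gridLen`. -/
def lenE : RExp := .add (.lit 1) (.log (.ofNat (.reg 1)))

/-- The expression for `gridExp`. -/
def expoE : RExp :=
  minE (.lit 2) (.add (.lit 1) (.div (.add (.ofNat (.reg 2)) (.lit 1)) lenE))

/-- The expression for the conjugate of `gridExp`. -/
def conjE : RExp := .div expoE (.sub expoE (.lit 1))

/-- The expression for `gridLip`. -/
def lipE : RExp :=
  .mul (.exp (.lit 1))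
    (.lip (maxE (.add (.lit 1) (.cell 0 (.lit 0))) (.sub expoE (.div (.lit 1) lenE))))

/-- The expression for `gridWeight`. -/
def weightE : RExp :=
  .div (.lit 1) (.mul (.add (.ofNat (.reg 2)) (.lit 1)) (.add (.ofNat (.reg 2)) (.lit 2)))

/-- The expression for `‖G‖_q`. -/
def normE : RExp := .absPow (.cell 3 (.lit 0)) (.div (.lit 1) conjE)

/-- The expression for `rate` after the current round. -/
def rateE : RExp :=
  .div (.lit 1) (.mul (.mul (.lit 2) (.mul lipE lipE))
    (.add (.mul (.mul (.lit 9) (.sub conjE (.lit 1))) (.ofNat (.reg 0)))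
      (.add (.ofNat (.reg 4)) (.lit 1))))

/-- The expression for the hyperbolic sine. -/
def sinhE (e : RExp) : RExp := .div (.sub (.exp e) (.exp (.sub (.lit 0) e))) (.lit 2)

/-- The expression for `stepSize`. -/
def stepE : RExp :=
  .mul (.mul (.exp (.mul rateE (.mul normE normE)))
      (.div (sinhE (.mul (.mul (.mul (.lit 2) rateE) normE) lipE)) lipE))
    (.absPow normE (.sub (.lit 1) conjE))

/-- The expression for the factor of `powGrad` in `basePlay`. -/
def coefE : RExp :=
  .mul (.mul weightE (.exp (.sub (.lit 0)
    (.div (.ofNat (.reg 4)) (.mul (.lit 2) (.ofNat (.reg 0))))))) stepE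

/-- The next summand of `∑ |G i| ^ q` is added. -/
def sumE : RExp := .add (.cell 3 (.lit 0)) (.absPow (.cell 2 (.reg 3)) conjE)

/-- The play of the learner for the current exponent is added. -/
def playE : RExp :=
  .add (.cell 1 (.reg 3)) (.mul coefE
    (.mul (.absPow (.cell 2 (.reg 3)) (.sub conjE (.lit 2))) (.cell 2 (.reg 3))))

/-- The part of the play that belongs to one exponent of the grid. -/
def gridCmd : Cmd :=
  .seq (.setR 3 (.lit 0) (.lit 0))
    (.seq (.loop 3 (.reg 1) (.setR 3 (.lit 0) sumE))
      (.loop 3 (.reg 1) (.setR 1 (.reg 3) playE)))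

/-- The learner that plays `gridPlay`. -/
def gridLearner : Learner where
  setup := .skip
  act := .seq (.loop 3 (.reg 1) (.setR 1 (.reg 3) (.lit 0)))
    (.loop 2 (.add (.reg 1) (.lit 1)) gridCmd)
  observe := .seq (.query 1 4 5)
    (.seq (.loop 3 (.reg 1) (.setR 2 (.reg 3) (.sub (.cell 2 (.reg 3)) (.cell 5 (.reg 3)))))
      (.setN 4 (.add (.reg 4) (.lit 1))))

/-- What the program remembers in round `t`, when `-G` is the sum of the past subgradients. -/
structure Mem {d : ℕ} (n : ℕ) (δ : ℝ) (t : ℕ) (G : Vec d) (s : State) : Prop where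
  cnt_n : s.cnt 0 = n
  cnt_d : s.cnt 1 = d
  cnt_t : s.cnt 4 = t
  arr_delta : s.arr 0 0 = δ
  arr_sum : ∀ k : Fin d, s.arr 2 k = G k
  pos_eq : s.pos = 0

theorem Mem.setCnt {d n t : ℕ} {δ : ℝ} {G : Vec d} {s : State} (h : Mem n δ t G s) {x : ℕ}
    (hx : x = 2 ∨ x = 3) (m : ℕ) : Mem n δ t G (s.setCnt x m) := by
  obtain ⟨h1, h2, h3, h4, h5, h6⟩ := h
  constructor
  · rw [State.setCnt_cnt, if_neg (by omega), h1]
  · rw [State.setCnt_cnt, if_neg (by omega), h2]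
  · rw [State.setCnt_cnt, if_neg (by omega), h3]
  · exact h4
  · exact h5
  · exact h6

theorem Mem.setArr {d n t : ℕ} {δ : ℝ} {G : Vec d} {s : State} (h : Mem n δ t G s) {a : ℕ}
    (ha : a ≠ 0) (ha' : a ≠ 2) (i : ℕ) (v : ℝ) : Mem n δ t G (s.setArr a i v) := by
  obtain ⟨h1, h2, h3, h4, h5, h6⟩ := h
  constructor
  · exact h1
  · exact h2
  · exact h3
  · rw [State.setArr_arr, if_neg (by tauto), h4]
  · intro k
    rw [State.setArr_arr, if_neg (by tauto), h5]
  · exact h6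

theorem minE_eval (lip : ℝ → ℝ) (s : State) (e₁ e₂ : RExp) :
    (minE e₁ e₂).eval lip s = min (e₁.eval lip s) (e₂.eval lip s) := by
  simp only [minE, RExp.eval, Rat.cast_one, Real.rpow_one, Rat.cast_ofNat]
  rcases le_total (e₁.eval lip s) (e₂.eval lip s) with h | h
  · rw [min_eq_left h, abs_of_nonpos (by linarith)]
    ring
  · rw [min_eq_right h, abs_of_nonneg (by linarith)]
    ring

theorem maxE_eval (lip : ℝ → ℝ) (s : State) (e₁ e₂ : RExp) :
    (maxE e₁ e₂).eval lip s = max (e₁.eval lip s) (e₂.eval lip s) := by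
  simp only [maxE, RExp.eval, Rat.cast_one, Real.rpow_one, Rat.cast_ofNat]
  rcases le_total (e₁.eval lip s) (e₂.eval lip s) with h | h
  · rw [max_eq_right h, abs_of_nonpos (by linarith)]
    ring
  · rw [max_eq_left h, abs_of_nonneg (by linarith)]
    ring

section Eval

variable {d n t j : ℕ} {δ : ℝ} {G : Vec d} {s : State} (lip : ℝ → ℝ)

theorem lenE_eval (h : Mem n δ t G s) : lenE.eval lip s = gridLen d := by
  simp [lenE, RExp.eval, NExp.eval, h.cnt_d, gridLen]

theorem expoE_eval (h : Mem n δ t G s) (hj : s.cnt 2 = j) : expoE.eval lip s = gridExp d j := by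
  rw [expoE, minE_eval]
  simp [RExp.eval, NExp.eval, lenE_eval lip h, hj, gridExp]

theorem conjE_eval (h : Mem n δ t G s) (hj : s.cnt 2 = j) :
    conjE.eval lip s = (gridExp d j).conjExponent := by
  simp [conjE, RExp.eval, expoE_eval lip h hj, Real.conjExponent]

theorem lipE_eval (h : Mem n δ t G s) (hj : s.cnt 2 = j) :
    lipE.eval lip s = gridLip lip d δ j := by
  simp [lipE, RExp.eval, NExp.eval, maxE_eval, expoE_eval lip h hj, lenE_eval lip h, h.arr_delta,
    gridLip, gridLookup]

theorem weightE_eval (hj : s.cnt 2 = j) : weightE.eval lip s = gridWeight j := by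
  simp [weightE, RExp.eval, NExp.eval, hj, gridWeight]

theorem normE_eval (h : Mem n δ t G s) (hj : s.cnt 2 = j)
    (hS : s.arr 3 0 = ∑ k, |G k| ^ (gridExp d j).conjExponent) :
    normE.eval lip s = lpNorm (gridExp d j).conjExponent G := by
  rw [lpNorm_eq (conjExponent_holder (one_lt_gridExp d j)).symm.pos, ← hS]
  have : 0 ≤ s.arr 3 0 := hS ▸ sum_abs_rpow_nonneg _ _
  simp only [normE, RExp.eval, NExp.eval, conjE_eval lip h hj, Rat.cast_one]
  rw [abs_of_nonneg this]

theorem rateE_eval (h : Mem n δ t G s) (hj : s.cnt 2 = j) :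
    rateE.eval lip s = rate n (gridExp d j).conjExponent (gridLip lip d δ j) (t + 1) := by
  simp [rateE, RExp.eval, NExp.eval, lipE_eval lip h hj, conjE_eval lip h hj, h.cnt_n, h.cnt_t,
    rate, sq]

theorem sinhE_eval (e : RExp) : (sinhE e).eval lip s = Real.sinh (e.eval lip s) := by
  simp [sinhE, RExp.eval, Real.sinh_eq]

theorem stepE_eval (h : Mem n δ t G s) (hj : s.cnt 2 = j)
    (hS : s.arr 3 0 = ∑ k, |G k| ^ (gridExp d j).conjExponent) :
    stepE.eval lip s =
      stepSize (rate n (gridExp d j).conjExponent (gridLip lip d δ j) (t + 1))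
        (gridExp d j).conjExponent (gridLip lip d δ j) (lpNorm (gridExp d j).conjExponent G) := by
  simp only [stepE, RExp.eval, sinhE_eval, rateE_eval lip h hj, normE_eval lip h hj hS,
    lipE_eval lip h hj, conjE_eval lip h hj, Rat.cast_ofNat, Rat.cast_one]
  rw [abs_of_nonneg (lpNorm_nonneg (conjExponent_holder (one_lt_gridExp d j)).symm.pos G),
    stepSize, sq]

theorem coefE_mul_powGrad (h : Mem n δ t G s) (hj : s.cnt 2 = j)
    (hS : s.arr 3 0 = ∑ k, |G k| ^ (gridExp d j).conjExponent) (k : Fin d) :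
    coefE.eval lip s * powGrad (gridExp d j).conjExponent G k =
      basePlay n (gridExp d j).conjExponent (gridLip lip d δ j) (gridWeight j) t G k := by
  simp [coefE, RExp.eval, NExp.eval, stepE_eval lip h hj hS, weightE_eval lip hj, h.cnt_n,
    h.cnt_t, basePlay]

end Eval

/-- An upper bound for the number of steps of `gridCmd`. -/
def gridCost (d : ℕ) : ℕ := 3 + (2 + d * (sumE.cost + 3) + (2 + d * (playE.cost + 3)))

/-- If `v` is the sum of the plays for the earlier points of the grid, `gridCmd` adds the play for
the current one. -/
theorem gridCmd_runs {d : ℕ} (E : Env d) {n t j : ℕ} {δ : ℝ} {G v : Vec d} {s : State}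
    (h : Mem n δ t G s) (hj : s.cnt 2 = j) (hv : ∀ k : Fin d, s.arr 1 k = v k) :
    Runs E gridCmd s (gridCost d) fun s' => Mem n δ t G s' ∧ ∀ k : Fin d, s'.arr 1 k = v k +
      basePlay n (gridExp d j).conjExponent (gridLip E.lip d δ j) (gridWeight j) t G k := by
  set q := (gridExp d j).conjExponent with hq
  refine Runs.seq (P := fun s => Mem n δ t G s ∧ s.cnt 2 = j ∧ (∀ k : Fin d, s.arr 1 k = v k) ∧
    s.arr 3 0 = 0) (Runs.setR ⟨h.setArr (by omega) (by omega) _ _, hj, ?_, ?_⟩) ?_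
  · intro k
    rw [State.setArr_arr, if_neg (by omega), hv]
  · simp [State.setArr_arr, NExp.eval, RExp.eval]
  rintro s ⟨h, hj, hv, h0⟩
  refine Runs.seq (B₁ := 2 + d * (sumE.cost + 3)) (B₂ := 2 + d * (playE.cost + 3))
    (P := fun s => Mem n δ t G s ∧ s.cnt 2 = j ∧ (∀ k : Fin d, s.arr 1 k = v k) ∧
      s.arr 3 0 = ∑ k ∈ range d, |s.arr 2 k| ^ q) ?_ ?_
  · have := Runs.loop (E := E) (x := 3) (e := .reg 1) (c := .setR 3 (.lit 0) sumE) (s := s)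
      (B := 1 + sumE.cost + 1)
      (fun i s => Mem n δ t G s ∧ s.cnt 2 = j ∧ (∀ k : Fin d, s.arr 1 k = v k) ∧
        s.arr 3 0 = ∑ k ∈ range i, |s.arr 2 k| ^ q) h.cnt_d ⟨h, hj, hv, by simpa using h0⟩ ?_
    · exact ⟨this.1, this.2.trans (by simp only [NExp.cost]; ring_nf; rfl)⟩
    rintro i hi s ⟨h, hj, hv, h0⟩
    have h' := h.setCnt (x := 3) (by omega) i
    have hj' : (s.setCnt 3 i).cnt 2 = j := by rw [State.setCnt_cnt, if_neg (by omega), hj]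
    refine Runs.setR ⟨h'.setArr (by omega) (by omega) _ _, hj', ?_, ?_⟩
    · intro k
      rw [State.setArr_arr, if_neg (by omega)]
      exact hv k
    · simp only [State.setArr_arr, NExp.eval, sumE, RExp.eval, conjE_eval _ h' hj',
        State.setCnt_cnt, if_true, and_self, sum_range_succ]
      rw [← hq]
      simpa [State.setCnt] using h0
  rintro s ⟨h, hj, hv, hS⟩
  have hS' : s.arr 3 0 = ∑ k, |G k| ^ q := by
    rw [hS, Finset.sum_range]
    exact sum_congr rfl fun k _ => by rw [h.arr_sum]
  clear hS
  have := Runs.loop (E := E) (x := 3) (e := .reg 1) (c := .setR 1 (.reg 3) playE) (s := s)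
    (B := 1 + playE.cost + 1)
    (fun i s => Mem n δ t G s ∧ s.cnt 2 = j ∧ (∀ k : Fin d, s.arr 1 k = v k +
      if k < i then basePlay n q (gridLip E.lip d δ j) (gridWeight j) t G k else 0) ∧
      s.arr 3 0 = ∑ k, |G k| ^ q) h.cnt_d ⟨h, hj, by simpa using hv, hS'⟩ ?_
  · refine ⟨⟨this.1.1, fun k => ?_⟩, this.2.trans (by simp only [NExp.cost]; ring_nf; rfl)⟩
    rw [this.1.2.2.1 k, if_pos k.2]
  rintro i hi s ⟨h, hj, hv, h0⟩
  have h' := h.setCnt (x := 3) (by omega) i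
  have hj' : (s.setCnt 3 i).cnt 2 = j := by rw [State.setCnt_cnt, if_neg (by omega), hj]
  refine Runs.setR ⟨h'.setArr (by omega) (by omega) _ _, hj', ?_, ?_⟩
  · intro k
    have hi3 : NExp.eval (s.setCnt 3 i) (.reg 3) = i := by simp [NExp.eval, State.setCnt_cnt]
    rw [State.setArr_arr, hi3]
    by_cases hk : (k : ℕ) = i
    · rw [if_pos ⟨rfl, hk⟩, if_pos (by omega), ← coefE_mul_powGrad E.lip h' hj' h0 k]
      simp only [playE, RExp.eval, hi3, conjE_eval _ h' hj', powGrad]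
      have h1 : (s.setCnt 3 i).arr 1 i = v k := by
        have := hv k
        rw [if_neg (by omega), add_zero, hk] at this
        exact this
      have h2 : (s.setCnt 3 i).arr 2 i = G k := by rw [← hk]; exact h'.arr_sum k
      rw [h1, h2]
      norm_num
    · rw [if_neg (by omega)]
      refine (hv k).trans ?_
      by_cases hki : (k : ℕ) < i
      · rw [if_pos hki, if_pos (by omega)]
      · rw [if_neg hki, if_neg (by omega)]
  · rw [State.setArr_arr, if_neg (by omega)]
    exact h0

/-- An upper bound for the number of steps of computing a play. -/
def actCost (d : ℕ) : ℕ := 2 + d * 4 + (4 + (d + 1) * (gridCost d + 1))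

theorem act_runs {d : ℕ} (E : Env d) {n t : ℕ} {δ : ℝ} {G : Vec d} {s : State}
    (h : Mem n δ t G s) :
    Runs E gridLearner.act s (actCost d) fun s' =>
      Mem n δ t G s' ∧ s'.read d 1 = gridPlay E.lip n δ t G := by
  refine Runs.seq (B₁ := 2 + d * 4) (B₂ := 4 + (d + 1) * (gridCost d + 1))
    (P := fun s => Mem n δ t G s ∧ ∀ k : Fin d, s.arr 1 k = 0) ?_ ?_
  · have := Runs.loop (E := E) (x := 3) (e := .reg 1) (c := .setR 1 (.reg 3) (.lit 0)) (s := s)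
      (B := 3) (fun i s => Mem n δ t G s ∧ ∀ k : Fin d, (k : ℕ) < i → s.arr 1 k = 0) h.cnt_d
      ⟨h, fun k hk => absurd hk (by omega)⟩ ?_
    · exact ⟨⟨this.1.1, fun k => this.1.2 k k.2⟩, this.2⟩
    rintro i hi s ⟨h, hv⟩
    have h' := h.setCnt (x := 3) (by omega) i
    refine Runs.setR ⟨h'.setArr (by omega) (by omega) _ _, fun k hk => ?_⟩
    have hi3 : NExp.eval (s.setCnt 3 i) (.reg 3) = i := by simp [NExp.eval, State.setCnt_cnt]
    rw [State.setArr_arr, hi3]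
    by_cases hki : (k : ℕ) = i
    · rw [if_pos ⟨rfl, hki⟩]
      simp [RExp.eval]
    · rw [if_neg (by omega)]
      exact hv k (by omega)
  rintro s ⟨h, hv⟩
  have := Runs.loop (E := E) (x := 2) (e := .add (.reg 1) (.lit 1)) (c := gridCmd) (s := s)
    (m := d + 1) (B := gridCost d)
    (fun m s => Mem n δ t G s ∧ ∀ k : Fin d, s.arr 1 k = ∑ j ∈ range m,
      basePlay n (gridExp d j).conjExponent (gridLip E.lip d δ j) (gridWeight j) t G k)
    (by simp [NExp.eval, h.cnt_d]) ⟨h, by simpa using hv⟩ ?_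
  · refine ⟨⟨this.1.1, ?_⟩, this.2⟩
    funext k
    exact this.1.2 k
  rintro j hj s ⟨h, hv⟩
  have h' := h.setCnt (x := 2) (by omega) j
  have := gridCmd_runs E h' (j := j) (by simp [State.setCnt_cnt]) (fun k => hv k)
  refine ⟨⟨this.1.1, fun k => ?_⟩, this.2⟩
  rw [this.1.2 k, sum_range_succ]

/-- An upper bound for the number of steps of processing a loss. -/
def observeCost (d : ℕ) : ℕ := d + 1 + (2 + d * 8 + 4)

theorem observe_runs {d : ℕ} (E : Env d) {n t : ℕ} {δ : ℝ} {G : Vec d} {s : State}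
    (h : Mem n δ t G s) :
    Runs E gridLearner.observe s (observeCost d) fun s' =>
      Mem n δ (t + 1) (G - E.loss.sub (s.read d 1)) s' := by
  set g := E.loss.sub (s.read d 1) with hg
  refine Runs.seq (B₁ := d + 1) (B₂ := 2 + d * 8 + 4)
    (P := fun s => Mem n δ t G s ∧ ∀ k : Fin d, s.arr 5 k = g k) ⟨⟨?_, ?_⟩, le_rfl⟩ ?_
  · have h' := h.setArr (a := 4) (by omega) (by omega) 0 (E.loss.val (s.read d 1))
    obtain ⟨h1, h2, h3, h4, h5, h6⟩ := h'
    refine ⟨h1, h2, h3, ?_, ?_, h6⟩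
    · simp only [Cmd.exec]
      rw [State.write_arr, if_neg (by omega)]
      exact h4
    · intro k
      simp only [Cmd.exec]
      rw [State.write_arr, if_neg (by omega)]
      exact h5 k
  · intro k
    simp only [Cmd.exec]
    rw [State.write_arr, if_pos rfl, dif_pos k.2]
  rintro s ⟨h, h5⟩
  refine Runs.seq (B₁ := 2 + d * 8) (B₂ := 4) (P := fun s => Mem n δ t (G - g) s) ?_ ?_
  · have := Runs.loop (E := E) (x := 3) (e := .reg 1)
      (c := .setR 2 (.reg 3) (.sub (.cell 2 (.reg 3)) (.cell 5 (.reg 3)))) (s := s) (B := 7)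
      (fun i s => Mem n δ t (fun k : Fin d => if (k : ℕ) < i then G k - g k else G k) s ∧
        ∀ k : Fin d, s.arr 5 k = g k) h.cnt_d ⟨by simpa using h, h5⟩ ?_
    · refine ⟨?_, this.2⟩
      have h6 := this.1.1
      have e : (fun k : Fin d => if (k : ℕ) < d then G k - g k else G k) = G - g := by
        funext k
        rw [if_pos k.2, Pi.sub_apply]
      rwa [e] at h6
    rintro i hi s ⟨h, h5⟩
    have h' := h.setCnt (x := 3) (by omega) i
    have hi3 : NExp.eval (s.setCnt 3 i) (.reg 3) = i := by simp [NExp.eval, State.setCnt_cnt]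
    refine ⟨⟨⟨h'.cnt_n, h'.cnt_d, h'.cnt_t, ?_, ?_, h'.pos_eq⟩, ?_⟩, le_rfl⟩
    · simp only [Cmd.exec]
      rw [State.setArr_arr, if_neg (by omega)]
      exact h'.arr_delta
    · intro k
      have h2 := h'.arr_sum k
      have h7 : (s.setCnt 3 i).arr 5 k = g k := h5 k
      simp only [Cmd.exec]
      rw [State.setArr_arr, hi3]
      by_cases hki : (k : ℕ) = i
      · rw [if_neg (by omega), hki] at h2
        rw [hki] at h7
        rw [if_pos ⟨rfl, hki⟩, if_pos (by omega)]
        simp only [RExp.eval, hi3, h2, h7]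
      · rw [if_neg (by omega), h2]
        by_cases hlt : (k : ℕ) < i
        · rw [if_pos hlt, if_pos (by omega)]
        · rw [if_neg hlt, if_neg (by omega)]
    · intro k
      simp only [Cmd.exec]
      rw [State.setArr_arr, if_neg (by omega)]
      exact h5 k
  · intro s h
    refine Runs.setN ⟨?_, ?_, ?_, h.arr_delta, h.arr_sum, h.pos_eq⟩
    · rw [State.setCnt_cnt, if_neg (by omega), h.cnt_n]
    · rw [State.setCnt_cnt, if_neg (by omega), h.cnt_d]
    · rw [State.setCnt_cnt, if_pos rfl]
      simp [NExp.eval, h.cnt_t]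

/-! ### The learner against nature -/

theorem start_mem (n d : ℕ) (δ : ℝ) : Mem n δ 0 (0 : Vec d) (Learner.start n d δ) := by
  constructor <;> simp [Learner.start]

/-- Minus the sum of the subgradients, and the list of plays, before round `t`. -/
def trajectory (lip : ℝ → ℝ) {d : ℕ} (n : ℕ) (δ : ℝ) (nature : Nature d) :
    ℕ → Vec d × List (Vec d)
  | 0 => (0, [])
  | t + 1 =>
      let r := trajectory lip n δ nature t
      let w := gridPlay lip n δ t r.1
      (r.1 - (nature r.2 []).sub w, r.2 ++ [w])

section Trajectory

variable (lip : ℝ → ℝ) {d : ℕ} (n : ℕ) (δ : ℝ) (nature : Nature d) (ω : ℕ → Bool)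

theorem playFrom_eq {t : ℕ} {G : Vec d} {s : State} (h : Mem n δ t G s) :
    gridLearner.playFrom d lip ω s = gridPlay lip n δ t G :=
  (act_runs (Learner.blindEnv d lip ω) h).1.2

theorem lossFrom_eq {t : ℕ} {G : Vec d} {s : State} (h : Mem n δ t G s) (l : List (Vec d)) :
    Learner.lossFrom d nature ω s l = nature l [] := by
  simp [Learner.lossFrom, h.pos_eq]

/-- No coins are tossed, so the state before each round does not depend on the coins. -/
theorem before_mem (t : ℕ) :
    Mem n δ t (trajectory lip n δ nature t).1
        (gridLearner.before n d δ lip nature ω t).1 ∧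
      (gridLearner.before n d δ lip nature ω t).2 = (trajectory lip n δ nature t).2 := by
  induction t with
  | zero => exact ⟨start_mem n d δ, rfl⟩
  | succ t ih =>
    obtain ⟨h1, h2⟩ := ih
    have hact := (act_runs (Learner.blindEnv d lip ω) h1).1
    have hobs := (observe_runs ⟨lip, Learner.lossFrom d nature ω
      (gridLearner.before n d δ lip nature ω t).1
      (gridLearner.before n d δ lip nature ω t).2, ω⟩ hact.1).1
    rw [hact.2] at hobs
    simp only [lossFrom_eq n δ nature ω h1, h2] at hobs
    refine ⟨?_, ?_⟩
    · simp only [Learner.before, trajectory, Learner.runObserve, lossFrom_eq n δ nature ω h1, h2]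
      exact hobs
    · simp only [Learner.before, trajectory, h2, playFrom_eq lip n δ ω h1]

theorem play_eq (t : ℕ) : gridLearner.play n d δ lip nature ω t =
    gridPlay lip n δ t (trajectory lip n δ nature t).1 :=
  playFrom_eq lip n δ ω (before_mem lip n δ nature ω t).1

theorem loss_eq (t : ℕ) : gridLearner.loss n d δ lip nature ω t =
    nature (trajectory lip n δ nature t).2 [] := by
  obtain ⟨h1, h2⟩ := before_mem lip n δ nature ω t
  rw [Learner.loss, lossFrom_eq n δ nature ω h1, h2]

theorem roundTime_le (t : ℕ) :
    gridLearner.roundTime n d δ lip nature ω t ≤ actCost d + observeCost d := by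
  obtain ⟨h1, h2⟩ := before_mem lip n δ nature ω t
  have hact := act_runs (Learner.blindEnv d lip ω) h1
  exact Nat.add_le_add hact.2 (observe_runs _ hact.1.1).2

/-- The first component of `trajectory` is what its name says, in the form used for the regret. -/
theorem trajectory_eq_negSum (t : ℕ) : (trajectory lip n δ nature t).1 =
    negSum (fun s => (nature (trajectory lip n δ nature s).2 []).sub
      (gridPlay lip n δ s (trajectory lip n δ nature s).1)) t := by
  induction t with
  | zero => funext i; simp [trajectory, negSum]
  | succ t ih =>
    rw [negSum_succ, ← ih]
    rfl

end Trajectory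

theorem regret_le {n d : ℕ} {δ : ℝ} {L : ℝ → ℝ} (hδ : 0 < δ) (hδ1 : δ ≤ 1)
    (hL : ∀ p ∈ Set.Icc (1 + δ) 2, 1 ≤ L p) (nature : Nature d)
    (hnat : ∀ (h : List (Vec d)) (b : List Bool), (nature h b).IsConvex ∧
      ∀ p ∈ Set.Icc (1 + δ) 2, DualLipschitz p (L p) (nature h b).val)
    (ω : ℕ → Bool) (w : Vec d) {p : ℝ} (hp : p ∈ Set.Icc (1 + δ) 2) :
    gridLearner.regret n d δ (lipTable L) nature ω w ≤
      67 * ((lpNorm p w + 1) * L p *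
        Real.sqrt (n * Real.log ((lpNorm p w + 1) * L p * max 1 (Real.log d) * n) / (p - 1))) := by
  obtain ⟨g, hg⟩ : ∃ g : ℕ → Vec d, g = fun s =>
    (nature (trajectory (lipTable L) n δ nature s).2 []).sub
      (gridPlay (lipTable L) n δ s (trajectory (lipTable L) n δ nature s).1) := ⟨_, rfl⟩
  have htraj : ∀ t, (trajectory (lipTable L) n δ nature t).1 = negSum g t := fun t => by
    rw [hg]
    exact trajectory_eq_negSum _ _ _ _ t
  refine le_trans ?_ (sum_gridPlay_le hδ hδ1 hL (n := n) g ?_ w hp)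
  · rw [Learner.regret, ← sum_sub_distrib]
    refine sum_le_sum fun t _ => ?_
    rw [loss_eq, play_eq]
    have hs := (hnat (trajectory (lipTable L) n δ nature t).2 []).1.2
      (gridPlay (lipTable L) n δ t (trajectory (lipTable L) n δ nature t).1) w
    have e : ∑ i, g t i * (gridPlay (lipTable L) n δ t (negSum g t) i - w i) =
        -∑ i, g t i * (w i - gridPlay (lipTable L) n δ t (negSum g t) i) := by
      rw [← sum_neg_distrib]
      exact sum_congr rfl fun i _ => by ring
    rw [e, ← htraj, hg]
    linarith
  · intro t _ p hp
    rw [hg]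
    exact (hnat _ []).2 p hp _ _ ((hnat _ []).1.2 _)

/-- A constant that dominates the step counts. -/
def stepConst : ℕ := sumE.cost + playE.cost + 60

theorem cost_le (n d : ℕ) : actCost d + observeCost d ≤ stepConst * (n + d + 1) ^ stepConst := by
  have h1 : actCost d + observeCost d ≤ stepConst * (d + 1) ^ 2 := by
    unfold actCost observeCost gridCost stepConst
    nlinarith [Nat.zero_le (d * sumE.cost), Nat.zero_le (d * playE.cost), Nat.zero_le (d * d)]
  refine h1.trans (Nat.mul_le_mul_left _ ?_)
  calc (d + 1) ^ 2 ≤ (n + d + 1) ^ 2 := Nat.pow_le_pow_left (by omega) 2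
    _ ≤ (n + d + 1) ^ stepConst := Nat.pow_le_pow_right (by omega) (by unfold stepConst; omega)

instance : MeasureTheory.IsProbabilityMeasure coinMeasure := by
  have : MeasureTheory.IsProbabilityMeasure (PMF.uniformOfFintype Bool).toMeasure :=
    PMF.toMeasure.isProbabilityMeasure _
  unfold coinMeasure
  infer_instance

end OnlineLp

end

theorem theorem4 :
    ∃ (A : OnlineLp.Learner) (C : ℝ) (k : ℕ),
      ∀ (n d : ℕ) (δ : ℝ) (L : ℝ → ℝ), 0 < δ → δ ≤ 1 →
        (∀ p ∈ Set.Icc (1 + δ) 2, 1 ≤ L p) →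
        ∀ nature : OnlineLp.Nature d,
          (∀ (h : List (OnlineLp.Vec d)) (b : List Bool), (nature h b).IsConvex ∧
            ∀ p ∈ Set.Icc (1 + δ) 2, OnlineLp.DualLipschitz p (L p) (nature h b).val) →
          (∀ ω : ℕ → Bool,
            (A.runSetup n d δ (OnlineLp.lipTable L) ω).2 ≤ k * (n + d + 1) ^ k ∧
            ∀ t < n,
              A.roundTime n d δ (OnlineLp.lipTable L) nature ω t ≤ k * (n + d + 1) ^ k) ∧
          ∀ (w : OnlineLp.Vec d), ∀ p ∈ Set.Icc (1 + δ) 2,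
            MeasureTheory.Integrable
              (fun ω => A.regret n d δ (OnlineLp.lipTable L) nature ω w) OnlineLp.coinMeasure ∧
            ∫ ω, A.regret n d δ (OnlineLp.lipTable L) nature ω w ∂OnlineLp.coinMeasure ≤
              C * ((OnlineLp.lpNorm p w + 1) * L p *
                Real.sqrt (n * Real.log ((OnlineLp.lpNorm p w + 1) * L p *
                  max 1 (Real.log d) * n) / (p - 1))) := by
  refine ⟨OnlineLp.gridLearner, 67, OnlineLp.stepConst, ?_⟩
  intro n d δ L hδ hδ1 hL nature hnat
  refine ⟨fun ω => ⟨?_, fun t _ => ?_⟩, fun w p hp => ?_⟩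
  · refine le_trans ?_ (OnlineLp.cost_le n d)
    exact (show 1 ≤ OnlineLp.observeCost d by unfold OnlineLp.observeCost; omega).trans
      (Nat.le_add_left _ _)
  · exact (OnlineLp.roundTime_le _ n δ nature ω t).trans (OnlineLp.cost_le n d)
  · -- the learner is deterministic, so its regret is a constant function of the coins
    have hconst : (fun ω => OnlineLp.gridLearner.regret n d δ (OnlineLp.lipTable L) nature ω w) =
        fun _ => OnlineLp.gridLearner.regret n d δ (OnlineLp.lipTable L) nature
          (fun _ => false) w := by
      funext ω
      simp only [OnlineLp.Learner.regret, OnlineLp.loss_eq, OnlineLp.play_eq]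
    rw [hconst]
    refine ⟨MeasureTheory.integrable_const _, ?_⟩
    rw [MeasureTheory.integral_const]
    simpa using OnlineLp.regret_le hδ hδ1 hL nature hnat (fun _ => false) w hp
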